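/- **Notation.** All functions are Lebesgue measurable on $(0,\infty)$, functions equal a.e. being identified; $f^*(t)=\inf\{\lambda>0: |\{|f|>\lambda\}|\le t\}$ is the non-increasing rearrangement. A rearrangement-invariant (r.i.) norm is a functional $\rho$ on the $[0,\infty]$-valued measurable functions satisfying: (P1) $\rho(f)=0$ iff $f=0$ a.e., $\rho(\lambda f)=\lambda\rho(f)$ for $\lambda\ge0$, $\rho(f+g)\le\rho(f)+\rho(g)$; (P2) $f\le g$ a.e. implies $\rho(f)\le\rho(g)$; (P3) $f_j\nearrow f$ a.e. implies $\rho(f_j)\nearrow\rho(f)$; (P4) $\rho(\chi_G)<\infty$ if $|G|<\infty$; (P5) if $|G|<\infty$ there is $C_G<\infty$ with $\int_G f\le C_G\,\rho(f)$ for all $f \ge 0$; (P6) $\rho(f)=\rho(g)$ if $f^*=g^*$. Its r.i. space is $X=\{f:\|f\|_X:=\rho(|f|)<\infty\}$; the associate norm is $\rho'(g)=\sup\{\int_0^\infty fg: f\ge0,\ \rho(f)\le1\}$, with space $X'$; $\varphi_X(t)=\|\chi_{(0,t)}\|_X$ is the fundamental function. Let $\varphi_X^{-1}(y)=\sup\{s>0:\varphi_X(s)\le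 y\}$, with $\sup\emptyset=0$ (this is the ordinary inverse on the range of $\varphi_X$ if $\varphi_X$ is strictly increasing and unbounded). A function $\theta:(0,\infty)\to(0,\infty)$ is quasiconcave if $\theta(t)$ and $t/\theta(t)$ are non-decreasing. Let $E_tf(s)=f(s/t)$, let $\|E_t\|_X$ be its operator norm on $X$, and $E(X)(t)=t/\|E_t\|_X$. Put $\|f\|_{m_\varphi}=\sup_{t>0}\varphi(t)f^*(t)$ and $\|f\|_{L^{1,\infty}}=\sup_{t>0}tf^*(t)$. For $a\ge 0$ let $S_af(t)=\int_0^\infty a(st)f(s)\,ds$; $S_a\colon A\to B$ means that this integral converges absolutely for all $f\in A$ and $t>0$, that $S_af\in B$, and that $\|S_af\|_B\le C\|f\|_A$ with $C<\infty$ independent of $f$. For an r.i. space $X$ and $\varphi:(0,\infty)\to(0,\infty)$ put $\overline\varphi(t)=t/\varphi(t)$, $\tilde\psi(t)=\varphi_X^{-1}(1/\overline\varphi(t))$ and $$R_1f(t)=\frac1{\varphi(t)}\bigl\|f^*\chi_{(0,\tilde\psi(t))}\bigr\|_X .$$ **Theorem.** Let $X$ be an r.i. space with $\varphi_X$ strictly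 increasing and unbounded, and let $\overline\varphi$ be quasiconcave, unbounded and strictly increasing with $\overline\varphi(0+)=0$. Let $Y\subset X+L^\infty$ be an r.i. space with $\min\{1/\varphi(t),1/t\}\in Y'$. Then $\rho(f)=\|R_1f\|_{Y'}$, $f\ge0$, is an r.i. norm, and so is its associate norm $\rho'$; let $Z$ be the r.i. space of $\rho'$. If $a\ge0$ is non-increasing on $(0,\infty)$ with $S_a\colon X\to m_\varphi$ and $S_a\colon L^\infty\to L^{1,\infty}$, then $S_a\colon Y\to Z$. **Corollary.** Let $X$ be an r.i. space such that for $\varphi=E(X)$ the function $\overline\varphi$ is quasiconcave, unbounded and strictly increasing with $\overline\varphi(0+)=0$. Let $Y\subset X+L^\infty$ be an r.i. space with $\min\{1/\varphi(t),1/t\}\in Y'$. Then $\rho(f)=\|R_1f\|_{Y'}$, $f\ge0$, is an r.i. norm, and so is $\rho'$; let $Z$ be the r.i. space of $\rho'$. If $a\in X'\cap L^1$ is non-negative and non-increasing, then $S_a\colon Y\to Z$. -/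

import Mathlib

open MeasureTheory Set Filter Topology
open scoped ENNReal NNReal

noncomputable section

namespace RISpace

/-- Lebesgue measure on the half-line `(0,∞)`. Functions on `(0,∞)` are represented by functions on
`ℝ`, and only their restriction to `(0,∞)` matters: every measurability, integral and almost
everywhere statement below refers to this measure. -/
def mu : Measure ℝ := volume.restrict (Ioi 0)

/-- The non-increasing rearrangement
`f^*(t) = inf {l : |{x ∈ (0,∞) : f x > l}| ≤ t}` of a nonnegative function
(allowing `l = 0` and `l = ∞` does not change the infimum). -/
def rearr (f : ℝ → ℝ≥0∞) (t : ℝ) : ℝ≥0∞ :=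
  sInf {l : ℝ≥0∞ | mu {x | l < f x} ≤ ENNReal.ofReal t}

/-- Rearrangement-invariant Banach function norms on the nonnegative (extended-valued) Lebesgue
measurable functions on `(0,∞)`: properties (P1) (three fields), (P2), ..., (P6). -/
structure IsRINorm (ρ : (ℝ → ℝ≥0∞) → ℝ≥0∞) : Prop where
  eq_zero_iff : ∀ f, AEMeasurable f mu → (ρ f = 0 ↔ f =ᵐ[mu] 0)
  smul : ∀ (c : ℝ≥0) (f), AEMeasurable f mu → ρ (fun x => (c : ℝ≥0∞) * f x) = c * ρ f
  add_le : ∀ f g, AEMeasurable f mu → AEMeasurable g mu → ρ (fun x => f x + g x) ≤ ρ f + ρ g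
  mono : ∀ f g, AEMeasurable f mu → AEMeasurable g mu → f ≤ᵐ[mu] g → ρ f ≤ ρ g
  fatou : ∀ (u : ℕ → ℝ → ℝ≥0∞) (f), (∀ j, AEMeasurable (u j) mu) → AEMeasurable f mu →
    (∀ᵐ x ∂mu, Monotone (fun j => u j x)) →
    (∀ᵐ x ∂mu, Tendsto (fun j => u j x) atTop (𝓝 (f x))) →
    Tendsto (fun j => ρ (u j)) atTop (𝓝 (ρ f))
  indicator_lt_top : ∀ G : Set ℝ, MeasurableSet G → mu G < ∞ → ρ (G.indicator 1) < ∞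
  lintegral_le : ∀ G : Set ℝ, MeasurableSet G → mu G < ∞ →
    ∃ C : ℝ≥0, ∀ f, AEMeasurable f mu → ∫⁻ x in G, f x ∂mu ≤ C * ρ f
  rearr_inv : ∀ f g, AEMeasurable f mu → AEMeasurable g mu →
    (∀ t, 0 < t → rearr f t = rearr g t) → ρ f = ρ g

/-- The function space determined by a functional `N` on nonnegative functions: all measurable `f`
with `N |f| < ∞`. (Members of an r.i. space are finite a.e., hence real-valued functions.) -/
def space (N : (ℝ → ℝ≥0∞) → ℝ≥0∞) : Set (ℝ → ℝ) :=
  {f | AEMeasurable f mu ∧ N (fun x => ‖f x‖ₑ) < ∞}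

/-- The sum of two spaces of functions, as a set. -/
def sumSpace (A B : Set (ℝ → ℝ)) : Set (ℝ → ℝ) :=
  {f | ∃ g ∈ A, ∃ h ∈ B, f = g + h}

/-- The associate functional `ρ'(g) = sup {∫ f g : f ≥ 0, ρ f ≤ 1}`. -/
def assoc (ρ : (ℝ → ℝ≥0∞) → ℝ≥0∞) (g : ℝ → ℝ≥0∞) : ℝ≥0∞ :=
  ⨆ (f : ℝ → ℝ≥0∞) (_ : AEMeasurable f mu) (_ : ρ f ≤ 1), ∫⁻ x, f x * g x ∂mu

/-- The `L^1` norm. -/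
def normL1 (f : ℝ → ℝ≥0∞) : ℝ≥0∞ := ∫⁻ x, f x ∂mu

/-- The `L^∞` norm. -/
def normLinf (f : ℝ → ℝ≥0∞) : ℝ≥0∞ := essSup f mu

/-- The `L^{1,∞}` quasinorm `sup_{t>0} t f^*(t)`. -/
def normWeakL1 (f : ℝ → ℝ≥0∞) : ℝ≥0∞ :=
  ⨆ (t : ℝ) (_ : 0 < t), ENNReal.ofReal t * rearr f t

/-- The functional `sup_{t>0} φ(t) f^*(t)` of the space `m_φ`. -/
def normM (φ : ℝ → ℝ) (f : ℝ → ℝ≥0∞) : ℝ≥0∞ :=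
  ⨆ (t : ℝ) (_ : 0 < t), ENNReal.ofReal (φ t) * rearr f t

/-- The fundamental function `φ_X(t) = ‖χ_{(0,t)}‖_X`. -/
def fundFn (ρ : (ℝ → ℝ≥0∞) → ℝ≥0∞) (t : ℝ) : ℝ≥0∞ := ρ ((Ioo 0 t).indicator 1)

/-- The inverse of the fundamental function, `φ_X^{-1}(y) = sup {s > 0 : φ_X(s) ≤ y}`. If `φ_X` is
strictly increasing and unbounded this is the usual inverse on the range of `φ_X`; for `y` below
that range (possible only if `φ_X(0+) > 0`) it is `0`. -/
def fundInv (ρ : (ℝ → ℝ≥0∞) → ℝ≥0∞) (y : ℝ) : ℝ :=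
  sSup {s : ℝ | 0 < s ∧ fundFn ρ s ≤ ENNReal.ofReal y}

/-- Positive quasiconcave functions on `(0,∞)`: `φ` and `t / φ(t)` are non-decreasing. -/
structure Quasiconcave (φ : ℝ → ℝ) : Prop where
  pos : ∀ t, 0 < t → 0 < φ t
  mono : MonotoneOn φ (Ioi 0)
  mono_div : MonotoneOn (fun t => t / φ t) (Ioi 0)

/-- The function `u ↦ u / φ(u)`. -/
def bar (φ : ℝ → ℝ) (u : ℝ) : ℝ := u / φ u

/-- `u ↦ u / φ(u)` is quasiconcave, unbounded, and has limit `0` at `0+`. -/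
structure BarAdmissible (φ : ℝ → ℝ) : Prop where
  quasiconcave : Quasiconcave (bar φ)
  unbounded : ∀ M : ℝ, ∃ t, 0 < t ∧ M < bar φ t
  tendsto_zero : Tendsto (bar φ) (𝓝[>] 0) (𝓝 0)

/-- The function `t ↦ φ_X^{-1}(1 / (t / φ(t)))`. -/
def psiTilde (ρ : (ℝ → ℝ≥0∞) → ℝ≥0∞) (φ : ℝ → ℝ) (t : ℝ) : ℝ := fundInv ρ (1 / bar φ t)

/-- `R₁ f (t) = φ(t)⁻¹ ‖f^* χ_{(0,ψ̃(t))}‖_X`, where `ρ` is the norm of `X`. -/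
def R1 (ρ : (ℝ → ℝ≥0∞) → ℝ≥0∞) (φ : ℝ → ℝ) (f : ℝ → ℝ≥0∞) (t : ℝ) : ℝ≥0∞ :=
  ENNReal.ofReal (1 / φ t) * ρ ((Ioo 0 (psiTilde ρ φ t)).indicator (rearr f))

/-- The functional `f ↦ ‖R₁ f‖_{Y'}`, where `ρX`, `ρY` are the norms of `X` and `Y`. -/
def normR1 (ρX : (ℝ → ℝ≥0∞) → ℝ≥0∞) (φ : ℝ → ℝ) (ρY : (ℝ → ℝ≥0∞) → ℝ≥0∞)
    (f : ℝ → ℝ≥0∞) : ℝ≥0∞ :=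
  assoc ρY (R1 ρX φ f)

/-- The operator norm on `X` of the dilation `E_t f (s) = f (s / t)`. -/
def dilationNorm (ρ : (ℝ → ℝ≥0∞) → ℝ≥0∞) (t : ℝ) : ℝ≥0∞ :=
  ⨆ (f : ℝ → ℝ≥0∞) (_ : AEMeasurable f mu) (_ : ρ f ≤ 1), ρ (fun s => f (s / t))

/-- The function `E(X)(t) = t / ‖E_t‖_X` (the dilation norm of an r.i. space is finite). -/
def EFn (ρ : (ℝ → ℝ≥0∞) → ℝ≥0∞) (t : ℝ) : ℝ := t / (dilationNorm ρ t).toReal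

/-- `S_a f (t) = ∫_0^∞ a(st) f(s) ds`. -/
def S (a f : ℝ → ℝ) (t : ℝ) : ℝ := ∫ s, a (s * t) * f s ∂mu

/-- `S_a` is defined on the space of `N₁` and bounded from it into the space of `N₂`. -/
def SBounded (a : ℝ → ℝ) (N₁ N₂ : (ℝ → ℝ≥0∞) → ℝ≥0∞) : Prop :=
  ∃ C : ℝ≥0, ∀ f ∈ space N₁,
    (∀ t, 0 < t → Integrable (fun s => a (s * t) * f s) mu) ∧
    S a f ∈ space N₂ ∧ N₂ (fun t => ‖S a f t‖ₑ) ≤ C * N₁ (fun x => ‖f x‖ₑ)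

/-- Nonnegative non-increasing functions on `(0,∞)`. -/
structure IsKernel (a : ℝ → ℝ) : Prop where
  nonneg : ∀ t, 0 < t → 0 ≤ a t
  anti : AntitoneOn a (Ioi 0)

end RISpace

end

open RISpace

namespace RISpace

/-! The kernel `a(st)` is symmetric in `s` and `t` and non-increasing in each, so the
Hardy–Littlewood inequality gives `∫ g S_a f ≤ ∫ f^* S_a g^*` (`lintegral_mul_kernOp_le`). By
duality, boundedness of `S_a` from `Y` into `Z` reduces to a pointwise bound of `S_a g^*` by `R₁ g`.

For that bound (`kernOp_rearr_le_R1`) cut `g^*` at `p = ψ̃(t)`. On `(0,p)` the hypothesis `X → m_φ`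
gives a multiple of `φ(t)⁻¹ ‖g^* χ_(0,p)‖_X = R₁ g(t)`. Beyond `p`, `g^*` is at most the constant
`g^*(p)`, whose image at `t` is `g^*(p) (∫ a) / t`. Since `1/t = φ(t)⁻¹ · (1/φ̄(t))`, where
`1/φ̄(t)` is comparable to `φ_X(p)`, and `g^*(p) φ_X(p) ≤ ‖g^* χ_(0,p)‖_X`, this is again at most a
multiple of `R₁ g(t)`. If `φ_X(0+) > 0`, then `ψ̃` may vanish for large `t`. There `g^*` is bounded,
and `S_a g^*` is dominated by `min(1/φ(t), 1/t)`, which lies in `Y'`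
(`exists_kernOp_rearr_le_weight`).

That `‖R₁ ·‖_{Y'}` is a norm rests on subadditivity of `f ↦ ‖f^* χ_(0,s)‖_X`, which holds because
this is the supremum of `‖f χ_E‖_X` over `|E| ≤ s` (`trunc_add_le`). That associates are
rearrangement invariant rests on a converse to Hardy–Littlewood (`lintegral_rearr_mul_le_assoc`).
Both use a nested family of sets, of every measure up to `m`, that follows the superlevel sets of a
given function (`lset`).

For the corollary, rescaling and Hölder give `S_a h(t) ≤ t⁻¹ ‖E_t‖_X ‖h‖_X ‖a‖_{X'}`, which is the
required bound with `φ = E(X)`. -/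

instance : SigmaFinite mu := by unfold mu; infer_instance

theorem mu_Ioi_ae : ∀ᵐ x ∂mu, 0 < x := ae_restrict_mem measurableSet_Ioi

theorem mu_Ioo (t : ℝ) : mu (Ioo 0 t) = ENNReal.ofReal t := by
  unfold mu
  have h : Ioo (0 : ℝ) t ⊆ Ioi 0 := fun x hx => hx.1
  rw [Measure.restrict_apply measurableSet_Ioo, inter_eq_left.2 h, Real.volume_Ioo, sub_zero]

theorem mu_ofReal_lt (D : ℝ≥0∞) : mu {x | ENNReal.ofReal x < D} = D := by
  by_cases hD : D = ⊤
  · subst hD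
    simp [mu]
  · rw [← ENNReal.ofReal_toReal hD]
    conv_rhs => rw [← mu_Ioo]
    refine measure_congr (eventuallyEq_set.2 ?_)
    filter_upwards [mu_Ioi_ae] with x hx
    rw [ENNReal.ofReal_lt_ofReal_iff_of_nonneg hx.le]
    exact ⟨fun h => ⟨hx, h⟩, fun h => h.2⟩

/-! ### Distribution functions and the non-increasing rearrangement. -/

/-- The infimum defining `rearr` is attained: the superlevel set at `l` is the increasing union of
those at levels decreasing to `l`. This Galois-type equivalence carries all later manipulations of
`rearr`. -/
theorem rearr_le_iff {f : ℝ → ℝ≥0∞} {t : ℝ} {l : ℝ≥0∞} :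
    rearr f t ≤ l ↔ mu {x | l < f x} ≤ ENNReal.ofReal t := by
  refine ⟨fun h => ?_, fun h => sInf_le h⟩
  rcases eq_or_ne l ⊤ with rfl | hl
  · simp
  obtain ⟨u, hu_anti, hu_mem, hu_lim⟩ :=
    exists_seq_strictAnti_tendsto' (lt_top_iff_ne_top.2 hl)
  have hset : {x | l < f x} = ⋃ n, {x | u n < f x} := by
    ext x
    simp only [mem_ofPred_eq, mem_iUnion]
    refine ⟨fun hx => ?_, fun ⟨n, hn⟩ => (hu_mem n).1.trans hn⟩
    exact (hu_lim.eventually (gt_mem_nhds hx)).exists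
  have hmono : Monotone fun n => {x | u n < f x} :=
    fun m n hmn x hx => (hu_anti.antitone hmn).trans_lt hx
  rw [hset, hmono.measure_iUnion]
  refine iSup_le fun n => ?_
  obtain ⟨l', hl', hlt⟩ := sInf_lt_iff.1 (h.trans_lt (hu_mem n).1)
  exact (measure_mono fun x hx => hlt.trans hx).trans hl'

theorem lt_rearr_iff {f : ℝ → ℝ≥0∞} {t : ℝ} {l : ℝ≥0∞} :
    l < rearr f t ↔ ENNReal.ofReal t < mu {x | l < f x} := by
  rw [← not_le, rearr_le_iff, not_le]

theorem rearr_antitone (f : ℝ → ℝ≥0∞) : Antitone (rearr f) := fun _ _ hst =>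
  rearr_le_iff.2 ((rearr_le_iff.1 le_rfl).trans (ENNReal.ofReal_le_ofReal hst))

theorem measurable_rearr (f : ℝ → ℝ≥0∞) : Measurable (rearr f) := (rearr_antitone f).measurable

/-- By `lt_rearr_iff` the superlevel set of `rearr f` is an initial interval whose length is the
measure of the superlevel set of `f`. -/
theorem mu_lt_rearr (f : ℝ → ℝ≥0∞) (l : ℝ≥0∞) : mu {x | l < rearr f x} = mu {x | l < f x} := by
  simp only [lt_rearr_iff]
  exact mu_ofReal_lt _

theorem rearr_mono_of_dist {f g : ℝ → ℝ≥0∞} (h : ∀ l, mu {x | l < f x} ≤ mu {x | l < g x}) (t : ℝ) :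
    rearr f t ≤ rearr g t :=
  rearr_le_iff.2 ((h _).trans (rearr_le_iff.1 le_rfl))

theorem rearr_congr_of_dist {f g : ℝ → ℝ≥0∞} (h : ∀ l, mu {x | l < f x} = mu {x | l < g x}) :
    rearr f = rearr g :=
  funext fun t => le_antisymm (rearr_mono_of_dist (fun l => (h l).le) t)
    (rearr_mono_of_dist (fun l => (h l).ge) t)

theorem rearr_rearr (f : ℝ → ℝ≥0∞) : rearr (rearr f) = rearr f :=
  rearr_congr_of_dist (mu_lt_rearr f)

theorem dist_mono_ae {f g : ℝ → ℝ≥0∞} (h : f ≤ᵐ[mu] g) (l : ℝ≥0∞) :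
    mu {x | l < f x} ≤ mu {x | l < g x} := by
  apply measure_mono_ae
  filter_upwards [h] with x hx hl
  exact lt_of_lt_of_le hl hx

theorem rearr_mono_ae {f g : ℝ → ℝ≥0∞} (h : f ≤ᵐ[mu] g) (t : ℝ) : rearr f t ≤ rearr g t :=
  rearr_mono_of_dist (dist_mono_ae h) t

theorem rearr_congr_ae {f g : ℝ → ℝ≥0∞} (h : f =ᵐ[mu] g) : rearr f = rearr g :=
  funext fun t => le_antisymm (rearr_mono_ae h.le t) (rearr_mono_ae h.symm.le t)

theorem dist_eq_of_rearr_eq {f g : ℝ → ℝ≥0∞} (h : ∀ t, 0 < t → rearr f t = rearr g t) (l : ℝ≥0∞) :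
    mu {x | l < f x} = mu {x | l < g x} := by
  rw [← mu_lt_rearr f, ← mu_lt_rearr g]
  have : rearr f =ᵐ[mu] rearr g := by
    filter_upwards [mu_Ioi_ae] with x hx using h x hx
  exact le_antisymm (dist_mono_ae this.le l) (dist_mono_ae this.symm.le l)

/-- An antitone function on the half-line dominates its rearrangement. -/
theorem rearr_le_self_of_antitoneOn {f : ℝ → ℝ≥0∞} (hf : AntitoneOn f (Ioi 0)) {t : ℝ} (ht : 0 < t) :
    rearr f t ≤ f t := by
  rw [rearr_le_iff, ← mu_Ioo]
  apply measure_mono_ae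
  filter_upwards [mu_Ioi_ae] with x hx hl
  refine ⟨hx, ?_⟩
  by_contra hxt
  exact absurd (lt_of_lt_of_le hl (hf ht hx (not_lt.1 hxt))) (lt_irrefl _)

/-- A lower bound for the rearrangement of a function that is antitone on the half-line. -/
theorem le_rearr_of_antitoneOn {f : ℝ → ℝ≥0∞} (hf : AntitoneOn f (Ioi 0)) {s t : ℝ}
    (hs : 0 ≤ s) (hst : s < t) : f t ≤ rearr f s := by
  by_contra! h
  have h1 := rearr_le_iff.1 (le_refl (rearr f s))
  have h2 : mu (Ioo 0 t) ≤ mu {x | rearr f s < f x} := measure_mono fun x hx =>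
    h.trans_le (hf hx.1 (hs.trans_lt hst) hx.2.le)
  rw [mu_Ioo] at h2
  exact absurd (h2.trans h1) (not_le.2 ((ENNReal.ofReal_lt_ofReal_iff (hs.trans_lt hst)).2 hst))

theorem dist_fatou {u : ℕ → ℝ → ℝ≥0∞} {f : ℝ → ℝ≥0∞}
    (hm : ∀ᵐ x ∂mu, Monotone (fun j => u j x))
    (hl : ∀ᵐ x ∂mu, Tendsto (fun j => u j x) atTop (𝓝 (f x))) (l : ℝ≥0∞) :
    mu {x | l < f x} = ⨆ j, mu {x | l < u j x} := by
  apply le_antisymm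
  · have h1 : mu {x | l < f x} ≤ mu (⋃ j, {x | l < u j x}) := by
      apply measure_mono_ae
      filter_upwards [hl] with x hx h
      exact mem_iUnion.2 ((hx.eventually (lt_mem_nhds h)).exists)
    refine h1.trans ?_
    rw [measure_iUnion_eq_iSup_accumulate]
    refine iSup_mono fun j => measure_mono_ae ?_
    filter_upwards [hm] with x hx h
    obtain ⟨i, hi⟩ := mem_iUnion.1 h
    obtain ⟨hij, hlt⟩ := mem_iUnion.1 hi
    exact lt_of_lt_of_le hlt (hx hij)
  · refine iSup_le fun j => dist_mono_ae ?_ l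
    filter_upwards [hm, hl] with x h1 h2 using h1.ge_of_tendsto h2 j

theorem tendsto_rearr {u : ℕ → ℝ → ℝ≥0∞} {f : ℝ → ℝ≥0∞}
    (hm : ∀ᵐ x ∂mu, Monotone (fun j => u j x))
    (hl : ∀ᵐ x ∂mu, Tendsto (fun j => u j x) atTop (𝓝 (f x))) (t : ℝ) :
    Tendsto (fun j => rearr (u j) t) atTop (𝓝 (rearr f t)) := by
  have hmono : Monotone fun j => rearr (u j) t := fun i j hij => by
    apply rearr_mono_ae
    filter_upwards [hm] with x hx using hx hij
  have : rearr f t = ⨆ j, rearr (u j) t := by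
    apply le_antisymm
    · refine le_of_forall_lt fun l hl' => ?_
      rw [lt_rearr_iff, dist_fatou hm hl, lt_iSup_iff] at hl'
      obtain ⟨j, hj⟩ := hl'
      exact (lt_rearr_iff.2 hj).trans_le (le_iSup (fun j => rearr (u j) t) j)
    · refine iSup_le fun j => rearr_mono_ae ?_ t
      filter_upwards [hm, hl] with x h1 h2 using h1.ge_of_tendsto h2 j
  rw [this]
  exact tendsto_atTop_iSup hmono

theorem rearr_const_mul (c : ℝ≥0) (f : ℝ → ℝ≥0∞) (t : ℝ) :
    rearr (fun x => (c : ℝ≥0∞) * f x) t = c * rearr f t := by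
  rcases eq_or_ne c 0 with rfl | hc
  · simp only [ENNReal.coe_zero, zero_mul]
    exact le_antisymm (rearr_le_iff.2 (by simp)) zero_le
  have hc0 : (c : ℝ≥0∞) ≠ 0 := by simpa using hc
  have key : ∀ l : ℝ≥0∞, mu {x | (c : ℝ≥0∞) * l < c * f x} = mu {x | l < f x} := fun l => by
    simp only [ENNReal.mul_lt_mul_iff_right hc0 ENNReal.coe_ne_top]
  apply le_antisymm
  · rw [rearr_le_iff, key, ← rearr_le_iff]
  · rw [mul_comm, ← ENNReal.le_div_iff_mul_le (Or.inl hc0) (Or.inl ENNReal.coe_ne_top),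
      rearr_le_iff, ← key, ENNReal.mul_div_cancel hc0 ENNReal.coe_ne_top, ← rearr_le_iff]

theorem dist_Ioo_indicator_rearr (f : ℝ → ℝ≥0∞) (s : ℝ) (l : ℝ≥0∞) :
    mu {x | l < (Ioo 0 s).indicator (rearr f) x} = min (ENNReal.ofReal s) (mu {x | l < f x}) := by
  rw [← mu_ofReal_lt (min _ _)]
  refine measure_congr (eventuallyEq_set.2 ?_)
  filter_upwards [mu_Ioi_ae] with x hx
  rw [lt_min_iff, ENNReal.ofReal_lt_ofReal_iff_of_nonneg hx.le, ← lt_rearr_iff]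
  by_cases h : x < s
  · rw [indicator_of_mem (show x ∈ Ioo 0 s from ⟨hx, h⟩)]
    simp [h]
  · rw [indicator_of_notMem (fun h' => h h'.2)]
    simp [h]

theorem mu_inter_lt_rearr (f g : ℝ → ℝ≥0∞) (l b : ℝ≥0∞) :
    mu ({x | l < rearr f x} ∩ {x | b < rearr g x}) =
      min (mu {x | l < f x}) (mu {x | b < g x}) := by
  rw [← mu_ofReal_lt (min _ _)]
  congr 1
  ext x
  simp only [mem_inter_iff, mem_ofPred_eq, lt_rearr_iff, lt_min_iff]

/-! ### Layer-cake formula for products and the Hardy–Littlewood inequality. -/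

theorem lintegral_layer (y : ℝ≥0∞) :
    y = ∫⁻ l, {l : ℝ | ENNReal.ofReal l < y}.indicator 1 l ∂mu := by
  rw [lintegral_indicator_one (measurableSet_lt ENNReal.measurable_ofReal measurable_const),
    mu_ofReal_lt]

/-- Both factors are written as integrals of indicators of their superlevel sets and Tonelli is
applied. Integrals of products can then be compared through joint superlevel sets alone. -/
theorem lintegral_mul_eq_layer {f g : ℝ → ℝ≥0∞} (hf : AEMeasurable f mu) (hg : AEMeasurable g mu) :
    ∫⁻ x, f x * g x ∂mu = ∫⁻ l, ∫⁻ b,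
      mu ({x | ENNReal.ofReal l < f x} ∩ {x | ENNReal.ofReal b < g x}) ∂mu ∂mu := by
  wlog H : Measurable f ∧ Measurable g generalizing f g
  · have h1 := this hf.measurable_mk.aemeasurable hg.measurable_mk.aemeasurable
      ⟨hf.measurable_mk, hg.measurable_mk⟩
    have h2 : ∫⁻ x, f x * g x ∂mu = ∫⁻ x, hf.mk f x * hg.mk g x ∂mu := by
      apply lintegral_congr_ae
      filter_upwards [hf.ae_eq_mk, hg.ae_eq_mk] with x h h'
      rw [h, h']
    rw [h2, h1]
    refine lintegral_congr fun l => lintegral_congr fun b => measure_congr (eventuallyEq_set.2 ?_)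
    filter_upwards [hf.ae_eq_mk, hg.ae_eq_mk] with x h h'
    simp only [mem_inter_iff, mem_ofPred_eq, h, h']
  obtain ⟨hf, hg⟩ := H
  have key : ∀ x, f x * g x = ∫⁻ l, ∫⁻ b, {l : ℝ | ENNReal.ofReal l < f x}.indicator 1 l *
      {b : ℝ | ENNReal.ofReal b < g x}.indicator 1 b ∂mu ∂mu := fun x => by
    conv_lhs => rw [lintegral_layer (f x), lintegral_layer (g x)]
    rw [← lintegral_mul_const]
    · refine lintegral_congr fun l => ?_
      rw [lintegral_const_mul]
      exact measurable_one.indicator (measurableSet_lt ENNReal.measurable_ofReal measurable_const)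
    · exact measurable_one.indicator (measurableSet_lt ENNReal.measurable_ofReal measurable_const)
  have mf : Measurable fun p : ℝ × ℝ => {l : ℝ | ENNReal.ofReal l < f p.1}.indicator
      (1 : ℝ → ℝ≥0∞) p.2 :=
    (measurable_one (α := ℝ≥0∞)).indicator (measurableSet_lt
      (ENNReal.measurable_ofReal.comp measurable_snd) (hf.comp measurable_fst))
  have mg : Measurable fun p : ℝ × ℝ => {l : ℝ | ENNReal.ofReal l < g p.1}.indicator
      (1 : ℝ → ℝ≥0∞) p.2 :=
    (measurable_one (α := ℝ≥0∞)).indicator (measurableSet_lt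
      (ENNReal.measurable_ofReal.comp measurable_snd) (hg.comp measurable_fst))
  simp_rw [key]
  rw [lintegral_lintegral_swap]
  · refine lintegral_congr fun l => ?_
    rw [lintegral_lintegral_swap]
    · refine lintegral_congr fun b => ?_
      rw [← lintegral_indicator_one ((measurableSet_lt measurable_const hf).inter
        (measurableSet_lt measurable_const hg))]
      refine lintegral_congr fun x => ?_
      simp only [indicator_apply, mem_ofPred_eq, mem_inter_iff, Pi.one_apply]
      split_ifs <;> simp_all
    · apply Measurable.aemeasurable
      exact (mf.comp (measurable_fst.prodMk measurable_const)).mul mg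
  · apply Measurable.aemeasurable
    refine Measurable.lintegral_prod_right'
      (f := fun p : (ℝ × ℝ) × ℝ => {l : ℝ | ENNReal.ofReal l < f p.1.1}.indicator 1 p.1.2 *
        {b : ℝ | ENNReal.ofReal b < g p.1.1}.indicator 1 p.2) ?_
    exact (mf.comp measurable_fst).mul
      (mg.comp ((measurable_fst.comp measurable_fst).prodMk measurable_snd))

theorem lintegral_mul_le_of_dist {f g f' g' : ℝ → ℝ≥0∞} (hf : AEMeasurable f mu)
    (hg : AEMeasurable g mu) (hf' : AEMeasurable f' mu) (hg' : AEMeasurable g' mu)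
    (h : ∀ l b, mu ({x | l < f x} ∩ {x | b < g x}) ≤ mu ({x | l < f' x} ∩ {x | b < g' x})) :
    ∫⁻ x, f x * g x ∂mu ≤ ∫⁻ x, f' x * g' x ∂mu := by
  rw [lintegral_mul_eq_layer hf hg, lintegral_mul_eq_layer hf' hg']
  exact lintegral_mono fun l => lintegral_mono fun b => h _ _

/-- The Hardy–Littlewood inequality. -/
theorem lintegral_mul_le_rearr {f g : ℝ → ℝ≥0∞} (hf : AEMeasurable f mu) (hg : AEMeasurable g mu) :
    ∫⁻ x, f x * g x ∂mu ≤ ∫⁻ x, rearr f x * rearr g x ∂mu := by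
  refine lintegral_mul_le_of_dist hf hg (measurable_rearr f).aemeasurable
    (measurable_rearr g).aemeasurable fun l b => ?_
  rw [mu_inter_lt_rearr]
  exact le_min (measure_mono inter_subset_left) (measure_mono inter_subset_right)

/-! ### Nested sets of prescribed measure adapted to a function. -/

/-- Initial segments of `(0,m)` for the order that sorts points by decreasing value of `h` and then
by position. -/
def lset (h : ℝ → ℝ≥0∞) (m : ℝ) (c : ℝ≥0∞) (x : ℝ) : Set ℝ :=
  {y | y ∈ Ioo 0 m ∧ (c < h y ∨ (h y = c ∧ y < x))}

theorem measurableSet_lset {h : ℝ → ℝ≥0∞} (hh : Measurable h) (m : ℝ) (c : ℝ≥0∞) (x : ℝ) :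
    MeasurableSet (lset h m c x) :=
  measurableSet_Ioo.inter ((measurableSet_lt measurable_const hh).union
    ((hh (measurableSet_singleton c)).inter measurableSet_Iio))

theorem lset_total (h : ℝ → ℝ≥0∞) (m : ℝ) (c c' : ℝ≥0∞) (x x' : ℝ) :
    lset h m c x ⊆ lset h m c' x' ∨ lset h m c' x' ⊆ lset h m c x := by
  rcases lt_trichotomy c c' with hc | rfl | hc
  · right
    rintro y ⟨hy, h1 | ⟨h1, h2⟩⟩
    · exact ⟨hy, Or.inl (hc.trans h1)⟩
    · exact ⟨hy, Or.inl (h1 ▸ hc)⟩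
  · rcases le_total x x' with hx | hx
    · left
      rintro y ⟨hy, h1 | ⟨h1, h2⟩⟩
      exacts [⟨hy, Or.inl h1⟩, ⟨hy, Or.inr ⟨h1, h2.trans_le hx⟩⟩]
    · right
      rintro y ⟨hy, h1 | ⟨h1, h2⟩⟩
      exacts [⟨hy, Or.inl h1⟩, ⟨hy, Or.inr ⟨h1, h2.trans_le hx⟩⟩]
  · left
    rintro y ⟨hy, h1 | ⟨h1, h2⟩⟩
    · exact ⟨hy, Or.inl (hc.trans h1)⟩
    · exact ⟨hy, Or.inl (h1 ▸ hc)⟩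

theorem lset_subset_Ioo (h : ℝ → ℝ≥0∞) (m : ℝ) (c : ℝ≥0∞) (x : ℝ) : lset h m c x ⊆ Ioo 0 m :=
  fun _ hy => hy.1

theorem lset_comparable_superlevel (h : ℝ → ℝ≥0∞) (m : ℝ) (c : ℝ≥0∞) (x : ℝ) (l : ℝ≥0∞) :
    lset h m c x ⊆ {y | l < h y} ∨ {y | l < (Ioo 0 m).indicator h y} ⊆ lset h m c x := by
  rcases lt_or_ge l c with hl | hl
  · left
    rintro y ⟨hy, h1 | ⟨h1, h2⟩⟩
    · exact hl.trans h1
    · exact hl.trans_eq h1.symm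
  · right
    intro y (hy : l < (Ioo 0 m).indicator h y)
    have hm : y ∈ Ioo 0 m := by
      by_contra hn
      rw [indicator_of_notMem hn] at hy
      exact not_lt_zero hy
    rw [indicator_of_mem hm] at hy
    exact ⟨hm, Or.inl (hl.trans_lt hy)⟩

/-- The level `c` is the rearrangement at `r`, so `{w > c}` has measure at most `r` and, within
`(0,m)`, `{w ≥ c}` has measure at least `r`. Moving the tie-breaking point `x` from `0` to `m`
passes from one to the other with a 1-Lipschitz measure, and the intermediate value theorem applies.
-/
theorem exists_lset_measure_eq {h : ℝ → ℝ≥0∞} (hh : Measurable h) {m r : ℝ} (hr : 0 ≤ r)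
    (hrm : r ≤ m) : ∃ c x, mu (lset h m c x) = ENNReal.ofReal r := by
  set w := (Ioo 0 m).indicator h with hw
  have mw : Measurable w := hh.indicator measurableSet_Ioo
  have hpos : ∀ {y l}, l < w y → y ∈ Ioo 0 m := fun {y l} hy => by
    by_contra hn
    rw [hw, indicator_of_notMem hn] at hy
    exact not_lt_zero hy
  set c := rearr w r with hc
  have hfin : ∀ s : Set ℝ, s ⊆ Ioo 0 m → mu s ≠ ⊤ := fun s hs =>
    ne_top_of_le_ne_top (by rw [mu_Ioo]; exact ENNReal.ofReal_ne_top) (measure_mono hs)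
  have hfin' := fun x => hfin _ (lset_subset_Ioo h m c x)
  set F : ℝ → ℝ := fun x => (mu (lset h m c x)).toReal with hF
  have hcont : Continuous F := by
    refine (LipschitzWith.of_le_add fun x y => ?_).continuous
    have hsub : lset h m c x ⊆ lset h m c y ∪ Ico y x := by
      rintro z ⟨hz, h1 | ⟨h1, h2⟩⟩
      · exact Or.inl ⟨hz, Or.inl h1⟩
      · rcases lt_or_ge z y with hzy | hzy
        · exact Or.inl ⟨hz, Or.inr ⟨h1, hzy⟩⟩
        · exact Or.inr ⟨hzy, h2⟩
    have hIco : mu (Ico y x) ≤ ENNReal.ofReal (dist x y) := by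
      refine (Measure.restrict_apply_le _ _).trans ?_
      rw [Real.volume_Ico]
      exact ENNReal.ofReal_le_ofReal (le_abs_self _)
    have h3 : mu (lset h m c x) ≤ mu (lset h m c y) + ENNReal.ofReal (dist x y) :=
      ((measure_mono hsub).trans (measure_union_le _ _)).trans (by gcongr)
    have h4 := ENNReal.toReal_mono (by finiteness [hfin' y]) h3
    rwa [ENNReal.toReal_add (hfin' y) ENNReal.ofReal_ne_top,
      ENNReal.toReal_ofReal dist_nonneg] at h4
  have h0 : F 0 ≤ r := by
    refine ENNReal.toReal_le_of_le_ofReal hr ?_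
    refine le_trans (measure_mono ?_) (rearr_le_iff.1 hc.ge)
    rintro z ⟨hz, h1 | ⟨h1, h2⟩⟩
    · change c < w z
      rwa [hw, indicator_of_mem hz]
    · exact absurd hz.1 h2.not_gt
  have hm : r ≤ F m := by
    rw [hF, ← ENNReal.ofReal_le_iff_le_toReal (hfin' m)]
    -- No levels lie below `c = 0`; in that case the segment ending at `m` is all of `(0,m)`.
    rcases eq_or_ne c 0 with h0 | h0
    · rw [show lset h m c m = Ioo 0 m from ?_, mu_Ioo]
      · exact ENNReal.ofReal_le_ofReal hrm
      · refine (lset_subset_Ioo _ _ _ _).antisymm fun z hz => ⟨hz, ?_⟩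
        rw [h0]
        rcases eq_or_ne (h z) 0 with h2 | h2
        · exact Or.inr ⟨h2, hz.2⟩
        · exact Or.inl (pos_iff_ne_zero.2 h2)
    · obtain ⟨u, hu, hu', hul⟩ := exists_seq_strictMono_tendsto' (pos_iff_ne_zero.2 h0)
      have hset : ⋂ n, {y | u n < w y} ⊆ lset h m c m := fun y hy => by
        have hy' : ∀ n, u n < w y := fun n => mem_iInter.1 hy n
        have hyJ := hpos (hy' 0)
        have : c ≤ w y := le_of_tendsto' hul fun n => (hy' n).le
        rw [hw, indicator_of_mem hyJ] at this
        rcases this.lt_or_eq with h1 | h1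
        · exact ⟨hyJ, Or.inl h1⟩
        · exact ⟨hyJ, Or.inr ⟨h1.symm, hyJ.2⟩⟩
      refine le_trans ?_ (measure_mono hset)
      rw [Antitone.measure_iInter]
      · exact le_iInf fun n => (lt_rearr_iff.1 (hu' n).2).le
      · exact fun i j hij y hy => lt_of_le_of_lt (hu.monotone hij) hy
      · exact fun n => (measurableSet_lt measurable_const mw).nullMeasurableSet
      · exact ⟨0, hfin _ fun y hy => hpos hy⟩
  obtain ⟨x, -, hx⟩ := intermediate_value_Icc (hr.trans hrm) hcont.continuousOn ⟨h0, hm⟩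
  exact ⟨c, x, by rw [← hx, ENNReal.ofReal_toReal (hfin' x)]⟩

theorem tendsto_const_mul_of_monotone (c : ℝ≥0∞) {u : ℕ → ℝ≥0∞} {L : ℝ≥0∞} (hu : Monotone u)
    (h : Tendsto u atTop (𝓝 L)) : Tendsto (fun n => c * u n) atTop (𝓝 (c * L)) := by
  rw [← iSup_eq_of_tendsto hu h, ENNReal.mul_iSup]
  exact tendsto_atTop_iSup fun i j hij => mul_le_mul_right (hu hij) c

/-! ### First properties of r.i. norms. -/

namespace IsRINorm

variable {ρ : (ℝ → ℝ≥0∞) → ℝ≥0∞}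

theorem rearr_eq (hρ : IsRINorm ρ) {f : ℝ → ℝ≥0∞} (hf : AEMeasurable f mu) : ρ (rearr f) = ρ f :=
  hρ.rearr_inv _ _ (measurable_rearr f).aemeasurable hf fun t _ => by rw [rearr_rearr]

theorem mono_dist (hρ : IsRINorm ρ) {f g : ℝ → ℝ≥0∞} (hf : AEMeasurable f mu)
    (hg : AEMeasurable g mu) (h : ∀ l, mu {x | l < f x} ≤ mu {x | l < g x}) : ρ f ≤ ρ g := by
  rw [← hρ.rearr_eq hf, ← hρ.rearr_eq hg]
  exact hρ.mono _ _ (measurable_rearr f).aemeasurable (measurable_rearr g).aemeasurable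
    (Eventually.of_forall (rearr_mono_of_dist h))

theorem congr_ae (hρ : IsRINorm ρ) {f g : ℝ → ℝ≥0∞} (hf : AEMeasurable f mu)
    (hg : AEMeasurable g mu) (h : f =ᵐ[mu] g) : ρ f = ρ g :=
  le_antisymm (hρ.mono f g hf hg h.le) (hρ.mono g f hg hf h.symm.le)

theorem indicator_Ioo_lt_top (hρ : IsRINorm ρ) (t : ℝ) : ρ ((Ioo 0 t).indicator 1) < ∞ :=
  hρ.indicator_lt_top _ measurableSet_Ioo (by rw [mu_Ioo]; exact ENNReal.ofReal_lt_top)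

theorem aemeasurable_indicator_one {G : Set ℝ} (hG : MeasurableSet G) :
    AEMeasurable (G.indicator (1 : ℝ → ℝ≥0∞)) mu :=
  (measurable_one.indicator hG).aemeasurable

theorem indicator_Ioo_ne_zero (hρ : IsRINorm ρ) {t : ℝ} (ht : 0 < t) :
    ρ ((Ioo 0 t).indicator 1) ≠ 0 := fun h => by
  have h1 := (hρ.eq_zero_iff _ (aemeasurable_indicator_one measurableSet_Ioo)).1 h
  have h2 : mu (Ioo 0 t) ≤ 0 := by
    rw [← lintegral_indicator_one measurableSet_Ioo, lintegral_congr_ae h1]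
    simp
  rw [mu_Ioo] at h2
  exact absurd h2 (not_le.2 (ENNReal.ofReal_pos.2 ht))

/-- Functions of finite norm are finite almost everywhere. -/
theorem ae_lt_top (hρ : IsRINorm ρ) {f : ℝ → ℝ≥0∞} (hf : AEMeasurable f mu) (h : ρ f ≠ ⊤) :
    ∀ᵐ x ∂mu, f x < ⊤ := by
  have h1 : ∀ n : ℕ, ∀ᵐ x ∂mu, x ∈ Ioo (0 : ℝ) n → f x < ⊤ := fun n => by
    obtain ⟨C, hC⟩ := hρ.lintegral_le (Ioo (0 : ℝ) n) measurableSet_Ioo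
      (by rw [mu_Ioo]; exact ENNReal.ofReal_lt_top)
    refine (ae_restrict_iff' measurableSet_Ioo).1 (ae_lt_top' hf.restrict ?_)
    exact ne_top_of_le_ne_top (ENNReal.mul_ne_top ENNReal.coe_ne_top h) (hC f hf)
  filter_upwards [ae_all_iff.2 h1, mu_Ioi_ae] with x hx h0
  obtain ⟨n, hn⟩ := exists_nat_gt x
  exact hx n ⟨h0, hn⟩

end IsRINorm

/-! ### The associate norm and resonance. -/

section Assoc

variable {ρ : (ℝ → ℝ≥0∞) → ℝ≥0∞}

theorem lintegral_mul_le_assoc {f : ℝ → ℝ≥0∞} (hf : AEMeasurable f mu) (h : ρ f ≤ 1)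
    (g : ℝ → ℝ≥0∞) : ∫⁻ x, f x * g x ∂mu ≤ assoc ρ g :=
  le_iSup_of_le f (le_iSup_of_le hf (le_iSup_of_le h le_rfl))

theorem assoc_le {g : ℝ → ℝ≥0∞} {C : ℝ≥0∞}
    (h : ∀ f, AEMeasurable f mu → ρ f ≤ 1 → ∫⁻ x, f x * g x ∂mu ≤ C) : assoc ρ g ≤ C :=
  iSup_le fun f => iSup_le fun hf => iSup_le fun hf1 => h f hf hf1

/-- Hölder's inequality, by normalising `f`; norm zero is treated apart. -/
theorem lintegral_mul_le_mul_assoc (hρ : IsRINorm ρ) {f : ℝ → ℝ≥0∞} (hf : AEMeasurable f mu)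
    (h : ρ f ≠ ⊤) (g : ℝ → ℝ≥0∞) : ∫⁻ x, f x * g x ∂mu ≤ ρ f * assoc ρ g := by
  rcases eq_or_ne (ρ f) 0 with h0 | h0
  · rw [lintegral_congr_ae (g := fun _ => 0)]
    · simp
    filter_upwards [(hρ.eq_zero_iff f hf).1 h0] with x hx
    simp [hx]
  set c : ℝ≥0 := ((ρ f).toNNReal)⁻¹ with hc
  have hcc : (c : ℝ≥0∞) = (ρ f)⁻¹ := by
    rw [hc, ENNReal.coe_inv (by simp [ENNReal.toNNReal_eq_zero_iff, h0, h]), ENNReal.coe_toNNReal h]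
  have h1 : ∫⁻ x, (c * f x) * g x ∂mu ≤ assoc ρ g := by
    refine lintegral_mul_le_assoc (hf.const_mul _) ?_ g
    rw [hρ.smul c f hf, hcc, ENNReal.inv_mul_cancel h0 h]
  have h2 : ∫⁻ x, f x * g x ∂mu = ρ f * ∫⁻ x, (c * f x) * g x ∂mu := by
    rw [← lintegral_const_mul' _ _ h]
    refine lintegral_congr fun x => ?_
    rw [hcc, ← mul_assoc, ← mul_assoc, ENNReal.mul_inv_cancel h0 h, one_mul]
  rw [h2]
  gcongr

theorem assoc_mono {f g : ℝ → ℝ≥0∞} (h : f ≤ᵐ[mu] g) : assoc ρ f ≤ assoc ρ g :=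
  assoc_le fun k hk hk1 => (lintegral_mono_ae (by
    filter_upwards [h] with x hx using mul_le_mul_right hx _)).trans (lintegral_mul_le_assoc hk hk1 g)

theorem assoc_const_mul (c : ℝ≥0∞) {f : ℝ → ℝ≥0∞} (hf : AEMeasurable f mu) :
    assoc ρ (fun x => c * f x) = c * assoc ρ f := by
  simp only [assoc, ENNReal.mul_iSup]
  refine iSup_congr fun k => iSup_congr fun hk => iSup_congr fun hk1 => ?_
  rw [← lintegral_const_mul'' (f := fun x => k x * f x) _ (hk.mul hf)]
  exact lintegral_congr fun x => mul_left_comm _ _ _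

theorem assoc_add_le {f g : ℝ → ℝ≥0∞} (hf : AEMeasurable f mu) :
    assoc ρ (fun x => f x + g x) ≤ assoc ρ f + assoc ρ g := by
  refine assoc_le fun k hk hk1 => ?_
  simp only [mul_add]
  rw [lintegral_add_left' (f := fun x => k x * f x) (hk.mul hf)]
  exact add_le_add (lintegral_mul_le_assoc hk hk1 f) (lintegral_mul_le_assoc hk hk1 g)

theorem assoc_fatou {u : ℕ → ℝ → ℝ≥0∞} {f : ℝ → ℝ≥0∞} (hu : ∀ j, AEMeasurable (u j) mu)
    (hm : ∀ᵐ x ∂mu, Monotone (fun j => u j x))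
    (hl : ∀ᵐ x ∂mu, Tendsto (fun j => u j x) atTop (𝓝 (f x))) :
    Tendsto (fun j => assoc ρ (u j)) atTop (𝓝 (assoc ρ f)) := by
  have hmono : Monotone fun j => assoc ρ (u j) := fun i j hij => by
    apply assoc_mono
    filter_upwards [hm] with x hx using hx hij
  have : assoc ρ f = ⨆ j, assoc ρ (u j) := by
    apply le_antisymm
    · refine assoc_le fun k hk hk1 => ?_
      have := lintegral_tendsto_of_tendsto_of_monotone (μ := mu)
        (f := fun j x => k x * u j x) (F := fun x => k x * f x) (fun j => hk.mul (hu j))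
        (by filter_upwards [hm] with x hx using fun i j hij => mul_le_mul_right (hx hij) _)
        (by filter_upwards [hm, hl] with x h1 h2 using tendsto_const_mul_of_monotone _ h1 h2)
      exact le_of_tendsto' this fun j =>
        (lintegral_mul_le_assoc hk hk1 _).trans (le_iSup (fun j => assoc ρ (u j)) j)
    · refine iSup_le fun j => assoc_mono ?_
      filter_upwards [hm, hl] with x h1 h2 using h1.ge_of_tendsto h2 j
  rw [this]
  exact tendsto_atTop_iSup hmono

theorem assoc_eq_zero_iff (hρ : IsRINorm ρ) {f : ℝ → ℝ≥0∞} (hf : AEMeasurable f mu) :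
    assoc ρ f = 0 ↔ f =ᵐ[mu] 0 := by
  constructor
  · intro h
    have h1 : ∀ n : ℕ, ∀ᵐ x ∂mu, (Ioo (0 : ℝ) n).indicator 1 x * f x = 0 := fun n => by
      have hm := IsRINorm.aemeasurable_indicator_one (measurableSet_Ioo (a := (0 : ℝ)) (b := n))
      refine (lintegral_eq_zero_iff' (hm.mul hf)).1 (nonpos_iff_eq_zero.1 ?_)
      refine (lintegral_mul_le_mul_assoc hρ hm (hρ.indicator_Ioo_lt_top n).ne f).trans ?_
      rw [h, mul_zero]
    filter_upwards [ae_all_iff.2 h1, mu_Ioi_ae] with x hx h0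
    obtain ⟨n, hn⟩ := exists_nat_gt x
    have := hx n
    rwa [indicator_of_mem (show x ∈ Ioo (0 : ℝ) n from ⟨h0, hn⟩), Pi.one_apply, one_mul] at this
  · intro h
    refine nonpos_iff_eq_zero.1 (assoc_le fun k hk _ => ?_)
    rw [lintegral_congr_ae (g := fun _ => 0)]
    · simp
    filter_upwards [h] with x hx
    simp [hx]

/-- The resonance property of the half-line, truncated to `(0,m)`. -/
theorem lintegral_indicator_rearr_mul_le_assoc (hρ : IsRINorm ρ) {f h : ℝ → ℝ≥0∞}
    (hh : Measurable h) (hf1 : ρ (rearr f) ≤ 1) (m : ℝ) :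
    ∫⁻ x, (Ioo 0 m).indicator (rearr f) x * rearr ((Ioo 0 m).indicator h) x ∂mu ≤ assoc ρ h := by
  -- Rational measures suffice and keep the supremum below countable, hence measurable.
  set ι := {q : ℚ // 0 < (q : ℝ) ∧ (q : ℝ) < m}
  have hE : ∀ q : ι, ∃ c x, mu (lset h m c x) = ENNReal.ofReal (q.1 : ℝ) := fun q =>
    exists_lset_measure_eq hh q.2.1.le q.2.2.le
  choose c x hcx using hE
  set E : ι → Set ℝ := fun q => lset h m (c q) (x q)
  have mE : ∀ q, MeasurableSet (E q) := fun q => measurableSet_lset hh _ _ _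
  -- `k` redistributes the values of `f^*` along the order in which `h` decreases, so that its
  -- superlevel sets are aligned with those of `h`.
  set k : ℝ → ℝ≥0∞ := fun y => ⨆ q : ι, (E q).indicator (fun _ => rearr f (q.1 : ℝ)) y with hk
  have mk : Measurable k := Measurable.iSup fun q => measurable_const.indicator (mE q)
  have hlt : ∀ l y, l < k y ↔ ∃ q : ι, y ∈ E q ∧ l < rearr f (q.1 : ℝ) := fun l y => by
    simp only [hk, lt_iSup_iff]
    refine exists_congr fun q => ?_
    by_cases hy : y ∈ E q
    · simp [hy]
    · simp [hy]
  have hk1 : ρ k ≤ 1 := by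
    refine le_trans (hρ.mono_dist mk.aemeasurable (measurable_rearr f).aemeasurable fun l => ?_) hf1
    have hset : {y | l < k y} = ⋃ q : {q : ι // l < rearr f (q.1 : ℝ)}, E q.1 := by
      ext y
      rw [mem_iUnion]
      exact (hlt l y).trans ⟨fun ⟨q, hy, hq⟩ => ⟨⟨q, hq⟩, hy⟩, fun ⟨q, hy⟩ => ⟨q.1, hy, q.2⟩⟩
    -- The sets `E q` form a chain, so the measure of the union is the supremum of those `q` with `l
    -- < f^*(q)`.
    rw [hset, Directed.measure_iUnion]
    · refine iSup_le fun q => ?_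
      rw [hcx, mu_lt_rearr]
      exact (lt_rearr_iff.1 q.2).le
    · intro p q
      rcases lset_total h m (c p.1) (c q.1) (x p.1) (x q.1) with hs | hs
      exacts [⟨q, hs, subset_rfl⟩, ⟨p, subset_rfl, hs⟩]
  refine le_trans ?_ (lintegral_mul_le_assoc mk.aemeasurable hk1 h)
  refine lintegral_mul_le_of_dist ((measurable_rearr f).indicator measurableSet_Ioo).aemeasurable
    (measurable_rearr _).aemeasurable mk.aemeasurable hh.aemeasurable fun l b => ?_
  have h1 : mu ({x | l < (Ioo 0 m).indicator (rearr f) x} ∩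
      {x | b < rearr ((Ioo 0 m).indicator h) x}) ≤
      min (min (ENNReal.ofReal m) (mu {x | l < f x})) (mu {x | b < (Ioo 0 m).indicator h x}) := by
    rw [← dist_Ioo_indicator_rearr, ← mu_lt_rearr ((Ioo 0 m).indicator h)]
    exact le_min (measure_mono inter_subset_left) (measure_mono inter_subset_right)
  refine h1.trans (le_of_forall_lt fun v hv => ?_)
  obtain ⟨hv1, hv2⟩ := lt_min_iff.1 hv
  obtain ⟨q, hq0, hvq, hq⟩ := ENNReal.lt_iff_exists_rat_btwn.1 hv1
  change v < ENNReal.ofReal q at hvq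
  change ENNReal.ofReal q < _ at hq
  obtain ⟨hqm, hqf⟩ := lt_min_iff.1 hq
  have hq0' : 0 < (q : ℝ) := ENNReal.ofReal_pos.1 (zero_le.trans_lt hvq)
  set p : ι := ⟨q, hq0', ((ENNReal.ofReal_lt_ofReal_iff_of_nonneg hq0'.le).1 hqm)⟩
  have hsub : E p ⊆ {y | l < k y} := fun y hy => (hlt l y).2 ⟨p, hy, lt_rearr_iff.2 hqf⟩
  -- Either `E p` lies inside `{h > b}` and contributes its measure `q > v`, or the superlevel set
  -- of `h` in `(0,m)` lies inside `E p`, hence inside `{k > l}`.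
  rcases lset_comparable_superlevel h m (c p) (x p) b with hs | hs
  · refine hvq.trans_le ?_
    rw [← hcx p]
    exact measure_mono (subset_inter hsub hs)
  · refine hv2.trans_le (measure_mono (subset_inter (hs.trans hsub) fun y hy => ?_))
    exact lt_of_lt_of_le (show b < (Ioo 0 m).indicator h y from hy) (indicator_le_self _ _ y)

theorem tendsto_indicator_Ioo_nat (f : ℝ → ℝ≥0∞) {x : ℝ} (hx : 0 < x) :
    Tendsto (fun n : ℕ => (Ioo (0 : ℝ) n).indicator f x) atTop (𝓝 (f x)) := by
  obtain ⟨N, hN⟩ := exists_nat_gt x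
  refine tendsto_atTop_of_eventually_const (i₀ := N) fun n hn => ?_
  exact indicator_of_mem (show x ∈ Ioo (0 : ℝ) n from ⟨hx, hN.trans_le (by exact_mod_cast hn)⟩) _

theorem monotone_indicator_Ioo_nat (f : ℝ → ℝ≥0∞) (x : ℝ) :
    Monotone fun n : ℕ => (Ioo (0 : ℝ) n).indicator f x := fun i j hij =>
  indicator_le_indicator_of_subset (Ioo_subset_Ioo_right (by exact_mod_cast hij))
    (fun _ => zero_le) x

/-- Monotone convergence removes the truncation to `(0,m)`. Together with Hardy–Littlewood this
shows that the associate norm depends only on the rearrangement. -/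
theorem lintegral_rearr_mul_le_assoc (hρ : IsRINorm ρ) {f h : ℝ → ℝ≥0∞} (hf : AEMeasurable f mu)
    (hh : AEMeasurable h mu) (hf1 : ρ f ≤ 1) :
    ∫⁻ x, rearr f x * rearr h x ∂mu ≤ assoc ρ h := by
  wlog H : Measurable h generalizing h
  · rw [rearr_congr_ae hh.ae_eq_mk]
    exact (this hh.measurable_mk.aemeasurable hh.measurable_mk).trans
      (assoc_mono hh.ae_eq_mk.symm.le)
  rw [← hρ.rearr_eq hf] at hf1
  have hmono : ∀ x, Monotone fun n : ℕ => rearr ((Ioo (0 : ℝ) n).indicator h) x :=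
    fun x i j hij => rearr_mono_ae (Eventually.of_forall
      fun y => monotone_indicator_Ioo_nat h y hij) x
  have hlim : ∀ x, Tendsto (fun n : ℕ => rearr ((Ioo (0 : ℝ) n).indicator h) x) atTop
      (𝓝 (rearr h x)) := fun x =>
    tendsto_rearr (Eventually.of_forall fun y => monotone_indicator_Ioo_nat h y)
      (by filter_upwards [mu_Ioi_ae] with y hy using tendsto_indicator_Ioo_nat h hy) x
  refine le_of_tendsto' (lintegral_tendsto_of_tendsto_of_monotone (μ := mu)
    (f := fun (n : ℕ) x => (Ioo (0 : ℝ) n).indicator (rearr f) x *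
      rearr ((Ioo (0 : ℝ) n).indicator h) x) (F := fun x => rearr f x * rearr h x)
    (fun n => (((measurable_rearr f).indicator measurableSet_Ioo).mul
      (measurable_rearr _)).aemeasurable)
    (Eventually.of_forall fun x i j hij => mul_le_mul'
      (monotone_indicator_Ioo_nat _ x hij) (hmono x hij)) ?_)
    fun n => lintegral_indicator_rearr_mul_le_assoc hρ H hf1 n
  filter_upwards [mu_Ioi_ae] with x hx
  obtain ⟨N, hN⟩ := exists_nat_gt x
  refine (tendsto_const_mul_of_monotone (rearr f x) (hmono x) (hlim x)).congr' ?_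
  filter_upwards [eventually_ge_atTop N] with n hn
  rw [indicator_of_mem (show x ∈ Ioo (0 : ℝ) n from ⟨hx, hN.trans_le (by exact_mod_cast hn)⟩)]

/-- The associate functional of an r.i. norm is an r.i. norm. -/
theorem isRINorm_assoc (hρ : IsRINorm ρ) : IsRINorm (assoc ρ) where
  eq_zero_iff f hf := assoc_eq_zero_iff hρ hf
  smul c f hf := assoc_const_mul c hf
  add_le f g hf _ := assoc_add_le hf
  mono f g _ _ h := assoc_mono h
  fatou u f hu _ hm hl := assoc_fatou hu hm hl
  indicator_lt_top G hG hfin := by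
    obtain ⟨C, hC⟩ := hρ.lintegral_le G hG hfin
    refine lt_of_le_of_lt (assoc_le (C := C) fun k hk hk1 => ?_) ENNReal.coe_lt_top
    have : ∀ x, k x * G.indicator 1 x = G.indicator k x := fun x => by
      by_cases hx : x ∈ G <;> simp [hx]
    simp only [this]
    rw [lintegral_indicator hG]
    exact (hC k hk).trans (mul_le_of_le_one_right' hk1)
  lintegral_le G hG hfin := by
    have hlt := hρ.indicator_lt_top G hG hfin
    refine ⟨(ρ (G.indicator 1)).toNNReal, fun f hf => ?_⟩
    rw [ENNReal.coe_toNNReal hlt.ne]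
    refine le_trans (le_of_eq ?_) (lintegral_mul_le_mul_assoc hρ
      (IsRINorm.aemeasurable_indicator_one hG) hlt.ne f)
    rw [← lintegral_indicator hG]
    refine lintegral_congr fun x => ?_
    by_cases hx : x ∈ G <;> simp [hx]
  rearr_inv := by
    have key : ∀ f g, AEMeasurable f mu → AEMeasurable g mu →
        (∀ t, 0 < t → rearr f t = rearr g t) → assoc ρ f ≤ assoc ρ g := fun f g hf hg h => by
      refine assoc_le fun k hk hk1 => (lintegral_mul_le_rearr hk hf).trans ?_
      rw [rearr_congr_of_dist (dist_eq_of_rearr_eq h)]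
      exact lintegral_rearr_mul_le_assoc hρ hk hg hk1
    exact fun f g hf hg h =>
      le_antisymm (key f g hf hg h) (key g f hg hf fun t ht => (h t ht).symm)

end Assoc

/-! ### Truncated norms and the fundamental function. -/

namespace IsRINorm

variable {ρ : (ℝ → ℝ≥0∞) → ℝ≥0∞}

theorem zero (hρ : IsRINorm ρ) : ρ (fun _ => 0) = 0 :=
  (hρ.eq_zero_iff _ aemeasurable_const).2 (Eventually.of_forall fun _ => rfl)

theorem mono_everywhere (hρ : IsRINorm ρ) {f g : ℝ → ℝ≥0∞} (hf : Measurable f)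
    (hg : Measurable g) (h : ∀ x, f x ≤ g x) : ρ f ≤ ρ g :=
  hρ.mono f g hf.aemeasurable hg.aemeasurable (Eventually.of_forall h)

theorem indicator_le_trunc (hρ : IsRINorm ρ) {f : ℝ → ℝ≥0∞} (hf : Measurable f) {E : Set ℝ}
    (hE : MeasurableSet E) {s : ℝ} (hEs : mu E ≤ ENNReal.ofReal s) :
    ρ (E.indicator f) ≤ ρ ((Ioo 0 s).indicator (rearr f)) := by
  refine hρ.mono_dist (hf.indicator hE).aemeasurable
    ((measurable_rearr f).indicator measurableSet_Ioo).aemeasurable fun l => ?_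
  rw [dist_Ioo_indicator_rearr]
  refine le_min ((measure_mono fun x hx => ?_).trans hEs)
    (dist_mono_ae (Eventually.of_forall fun x => indicator_le_self _ _ x) l)
  by_contra hn
  rw [mem_ofPred_eq, indicator_of_notMem hn] at hx
  exact not_lt_zero hx

/-- With `indicator_le_trunc` this identifies the truncated norm as a supremum over sets of measure
at most `s`, hence as a supremum of seminorm-like functionals. After restriction of `h` to `(0,n)`
with `n ≥ s`, an `lset` of measure exactly `s` captures its largest values. -/
theorem trunc_le_of_forall_indicator_le (hρ : IsRINorm ρ) {h : ℝ → ℝ≥0∞} (hh : Measurable h)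
    {s : ℝ} (hs : 0 ≤ s) {C : ℝ≥0∞}
    (hC : ∀ E, MeasurableSet E → mu E ≤ ENNReal.ofReal s → ρ (E.indicator h) ≤ C) :
    ρ ((Ioo 0 s).indicator (rearr h)) ≤ C := by
  have hmono : ∀ x, Monotone fun n : ℕ =>
      (Ioo 0 s).indicator (rearr ((Ioo (0 : ℝ) n).indicator h)) x := fun x i j hij =>
    indicator_le_indicator (rearr_mono_ae (Eventually.of_forall
      fun y => monotone_indicator_Ioo_nat h y hij) x)
  have hlim : ∀ x, Tendsto (fun n : ℕ =>
      (Ioo 0 s).indicator (rearr ((Ioo (0 : ℝ) n).indicator h)) x) atTop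
      (𝓝 ((Ioo 0 s).indicator (rearr h) x)) := fun x => by
    by_cases hx : x ∈ Ioo 0 s
    · simp only [indicator_of_mem hx]
      exact tendsto_rearr (Eventually.of_forall fun y => monotone_indicator_Ioo_nat h y)
        (by filter_upwards [mu_Ioi_ae] with y hy using tendsto_indicator_Ioo_nat h hy) x
    · simp only [indicator_of_notMem hx]
      exact tendsto_const_nhds
  refine le_of_tendsto (hρ.fatou _ _
    (fun n => ((measurable_rearr _).indicator measurableSet_Ioo).aemeasurable)
    ((measurable_rearr _).indicator measurableSet_Ioo).aemeasurable
    (Eventually.of_forall hmono) (Eventually.of_forall hlim)) ?_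
  obtain ⟨N, hN⟩ := exists_nat_gt s
  filter_upwards [eventually_ge_atTop N] with n hn
  have hsn : s ≤ n := hN.le.trans (by exact_mod_cast hn)
  obtain ⟨c, x, hcx⟩ := exists_lset_measure_eq hh hs hsn
  have mE := measurableSet_lset hh n c x
  refine le_trans (hρ.mono_dist ((measurable_rearr _).indicator measurableSet_Ioo).aemeasurable
    (hh.indicator mE).aemeasurable fun l => ?_) (hC _ mE hcx.le)
  rw [dist_Ioo_indicator_rearr]
  rcases lset_comparable_superlevel h n c x l with hsub | hsub
  · refine (min_le_left _ _).trans ?_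
    rw [← hcx]
    refine measure_mono fun y hy => ?_
    rw [mem_ofPred_eq, indicator_of_mem hy]
    exact hsub hy
  · refine (min_le_right _ _).trans (measure_mono fun y hy => ?_)
    have hy' : l < (Ioo (0 : ℝ) n).indicator h y := hy
    rw [mem_ofPred_eq, indicator_of_mem (hsub hy)]
    exact hy'.trans_le (indicator_le_self _ _ y)

/-- The truncated norms `‖f^* χ_{(0,s)}‖` are subadditive. -/
theorem trunc_add_le (hρ : IsRINorm ρ) {f g : ℝ → ℝ≥0∞} (hf : AEMeasurable f mu)
    (hg : AEMeasurable g mu) {s : ℝ} (hs : 0 ≤ s) :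
    ρ ((Ioo 0 s).indicator (rearr fun x => f x + g x)) ≤
      ρ ((Ioo 0 s).indicator (rearr f)) + ρ ((Ioo 0 s).indicator (rearr g)) := by
  wlog H : Measurable f ∧ Measurable g generalizing f g
  · have h1 := this hf.measurable_mk.aemeasurable hg.measurable_mk.aemeasurable
      ⟨hf.measurable_mk, hg.measurable_mk⟩
    have h2 : (fun x => f x + g x) =ᵐ[mu] fun x => hf.mk f x + hg.mk g x :=
      hf.ae_eq_mk.add hg.ae_eq_mk
    rwa [← rearr_congr_ae hf.ae_eq_mk, ← rearr_congr_ae hg.ae_eq_mk, ← rearr_congr_ae h2] at h1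
  obtain ⟨mf, mg⟩ := H
  refine hρ.trunc_le_of_forall_indicator_le (mf.add mg) hs fun E mE hE => ?_
  have : E.indicator (fun x => f x + g x) = fun x => E.indicator f x + E.indicator g x :=
    indicator_add E f g
  change ρ (E.indicator fun x => f x + g x) ≤ _
  rw [this]
  exact (hρ.add_le _ _ (mf.indicator mE).aemeasurable (mg.indicator mE).aemeasurable).trans
    (add_le_add (hρ.indicator_le_trunc mf mE hE) (hρ.indicator_le_trunc mg mE hE))

theorem fundFn_mono (hρ : IsRINorm ρ) : Monotone (fundFn ρ) := fun _ _ hst =>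
  hρ.mono_everywhere (measurable_one.indicator measurableSet_Ioo)
    (measurable_one.indicator measurableSet_Ioo)
    (indicator_le_indicator_of_subset (Ioo_subset_Ioo_right hst) fun _ => zero_le)

theorem fundFn_lt_top (hρ : IsRINorm ρ) (t : ℝ) : fundFn ρ t < ⊤ := hρ.indicator_Ioo_lt_top t

/-- `(0,2s)` splits into two pieces of measure `s`. Doubling takes the place of continuity of the
fundamental function in what follows. -/
theorem fundFn_double_le (hρ : IsRINorm ρ) (s : ℝ) :
    fundFn ρ (2 * s) ≤ 2 * fundFn ρ s := by
  have h1 : ρ ((Ico s (2 * s)).indicator 1) ≤ fundFn ρ s := by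
    refine hρ.mono_dist (aemeasurable_indicator_one measurableSet_Ico)
      (aemeasurable_indicator_one measurableSet_Ioo) fun l => ?_
    rcases lt_or_ge l 1 with hl | hl
    · calc mu {x | l < (Ico s (2 * s)).indicator 1 x} ≤ mu (Ico s (2 * s)) := by
            refine measure_mono fun x hx => ?_
            by_contra hn
            rw [mem_ofPred_eq, indicator_of_notMem hn] at hx
            exact not_lt_zero hx
        _ ≤ mu (Ioo 0 s) := by
            refine (Measure.restrict_apply_le _ _).trans ?_
            rw [mu_Ioo, Real.volume_Ico, two_mul, add_sub_cancel_right]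
        _ ≤ _ := measure_mono fun x hx => by
            rwa [mem_ofPred_eq, indicator_of_mem hx, Pi.one_apply]
    · rw [show {x | l < (Ico s (2 * s)).indicator (1 : ℝ → ℝ≥0∞) x} = ∅ from ?_]
      · simp
      · refine eq_empty_of_forall_notMem fun x (hx : l < _) => ?_
        have : (Ico s (2 * s)).indicator (1 : ℝ → ℝ≥0∞) x ≤ 1 := indicator_le_self _ _ x
        exact absurd (hx.trans_le this) hl.not_gt
  rw [two_mul (fundFn ρ s)]
  refine le_trans ?_ (add_le_add_right h1 _)
  refine le_trans ?_ (hρ.add_le _ _ (aemeasurable_indicator_one measurableSet_Ioo)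
    (aemeasurable_indicator_one measurableSet_Ico))
  refine hρ.mono_everywhere (measurable_one.indicator measurableSet_Ioo)
    ((measurable_one.indicator measurableSet_Ioo).add
      (measurable_one.indicator measurableSet_Ico)) fun x => ?_
  by_cases hx : x ∈ Ioo 0 (2 * s)
  · rcases lt_or_ge x s with h | h
    · rw [indicator_of_mem hx, indicator_of_mem (show x ∈ Ioo 0 s from ⟨hx.1, h⟩)]
      exact le_self_add
    · rw [indicator_of_mem hx, indicator_of_mem (show x ∈ Ico s (2 * s) from ⟨h, hx.2⟩)]
      exact le_add_self
  · rw [indicator_of_notMem hx]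
    exact zero_le

end IsRINorm

/-! ### Inverse of the fundamental function, up to a factor 2. -/

section FundInv

variable {ρ : (ℝ → ℝ≥0∞) → ℝ≥0∞}

theorem fundInv_nonneg (ρ : (ℝ → ℝ≥0∞) → ℝ≥0∞) (y : ℝ) : 0 ≤ fundInv ρ y :=
  Real.sSup_nonneg fun _ hs => hs.1.le

theorem bddAbove_fundInv (hρ : IsRINorm ρ)
    (hunb : ∀ M : ℝ≥0, ∃ t, 0 < t ∧ (M : ℝ≥0∞) < fundFn ρ t) (y : ℝ) :
    BddAbove {s : ℝ | 0 < s ∧ fundFn ρ s ≤ ENNReal.ofReal y} := by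
  obtain ⟨t, -, ht⟩ := hunb y.toNNReal
  refine ⟨t, fun s hs => ?_⟩
  by_contra! h
  exact absurd (ht.trans_le ((hρ.fundFn_mono h.le).trans hs.2)) (lt_irrefl _)

theorem le_fundInv (hρ : IsRINorm ρ)
    (hunb : ∀ M : ℝ≥0, ∃ t, 0 < t ∧ (M : ℝ≥0∞) < fundFn ρ t) {s y : ℝ} (hs : 0 < s)
    (h : fundFn ρ s ≤ ENNReal.ofReal y) : s ≤ fundInv ρ y :=
  le_csSup (bddAbove_fundInv hρ hunb y) ⟨hs, h⟩

theorem lt_fundFn_of_fundInv_lt (hρ : IsRINorm ρ)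
    (hunb : ∀ M : ℝ≥0, ∃ t, 0 < t ∧ (M : ℝ≥0∞) < fundFn ρ t) {s y : ℝ} (hs : 0 < s)
    (h : fundInv ρ y < s) : ENNReal.ofReal y < fundFn ρ s := by
  by_contra! h'
  exact absurd (le_fundInv hρ hunb hs h') h.not_ge

theorem fundInv_mono (hρ : IsRINorm ρ)
    (hunb : ∀ M : ℝ≥0, ∃ t, 0 < t ∧ (M : ℝ≥0∞) < fundFn ρ t) : Monotone (fundInv ρ) :=
  fun _ y' h => Real.sSup_le (fun _ hs => le_fundInv hρ hunb hs.1
    (hs.2.trans (ENNReal.ofReal_le_ofReal h))) (fundInv_nonneg ρ y')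

theorem fundFn_fundInv_le (hρ : IsRINorm ρ) {y : ℝ} (h : 0 < fundInv ρ y) :
    fundFn ρ (fundInv ρ y) ≤ 2 * ENNReal.ofReal y := by
  have hne : {s : ℝ | 0 < s ∧ fundFn ρ s ≤ ENNReal.ofReal y}.Nonempty := by
    by_contra hn
    rw [fundInv, not_nonempty_iff_eq_empty.1 hn, Real.sSup_empty] at h
    exact lt_irrefl _ h
  -- The supremum need not be attained, so an admissible `s` above half of it is taken and doubling
  -- is applied.
  obtain ⟨s, hs, hlt⟩ := exists_lt_of_lt_csSup hne (half_lt_self h)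
  have h1 := hρ.fundFn_double_le (fundInv ρ y / 2)
  rw [show 2 * (fundInv ρ y / 2) = fundInv ρ y by ring] at h1
  refine h1.trans ?_
  gcongr
  exact (hρ.fundFn_mono hlt.le).trans hs.2

theorem le_fundFn_fundInv (hρ : IsRINorm ρ)
    (hunb : ∀ M : ℝ≥0, ∃ t, 0 < t ∧ (M : ℝ≥0∞) < fundFn ρ t) {y : ℝ} (h : 0 < fundInv ρ y) :
    ENNReal.ofReal y ≤ 2 * fundFn ρ (fundInv ρ y) :=
  (lt_fundFn_of_fundInv_lt hρ hunb (by linarith : 0 < 2 * fundInv ρ y) (by linarith)).le.trans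
    (hρ.fundFn_double_le _)

end FundInv

/-! ### Consequences of quasiconcavity of `bar φ`. -/

namespace BarAdmissible

variable {φ : ℝ → ℝ}

theorem pos (hφ : BarAdmissible φ) {t : ℝ} (ht : 0 < t) : 0 < φ t :=
  (div_pos_iff_of_pos_left ht).1 (hφ.quasiconcave.pos t ht)

theorem mono (hφ : BarAdmissible φ) {s t : ℝ} (hs : 0 < s) (hst : s ≤ t) : φ s ≤ φ t := by
  have h := hφ.quasiconcave.mono_div hs (hs.trans_le hst) hst
  have key : ∀ u, 0 < u → u / bar φ u = φ u := fun u hu => by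
    have := (hφ.pos hu).ne'
    unfold bar
    field_simp
  simp only [key s hs, key t (hs.trans_le hst)] at h
  exact h

theorem le_two_mul_half (hφ : BarAdmissible φ) {t : ℝ} (ht : 0 < t) : φ t ≤ 2 * φ (t / 2) := by
  have h : t / 2 / φ (t / 2) ≤ t / φ t :=
    hφ.quasiconcave.mono (half_pos ht) ht (half_le_self ht.le)
  rw [div_le_div_iff₀ (hφ.pos (half_pos ht)) (hφ.pos ht)] at h
  nlinarith

theorem one_div_mul_one_div_bar (hφ : BarAdmissible φ) {t : ℝ} (ht : 0 < t) :
    1 / φ t * (1 / bar φ t) = 1 / t := by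
  have := (hφ.pos ht).ne'
  unfold bar
  field_simp

end BarAdmissible

/-! ### The functional `normR1` is an r.i. norm. -/

section R1

variable {ρX ρY : (ℝ → ℝ≥0∞) → ℝ≥0∞} {φ : ℝ → ℝ}

theorem psiTilde_antitoneOn (hX : IsRINorm ρX)
    (hunb : ∀ M : ℝ≥0, ∃ t, 0 < t ∧ (M : ℝ≥0∞) < fundFn ρX t) (hφ : BarAdmissible φ) :
    AntitoneOn (psiTilde ρX φ) (Ioi 0) := fun s hs _ ht hst =>
  fundInv_mono hX hunb (one_div_le_one_div_of_le (hφ.quasiconcave.pos s hs)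
    (hφ.quasiconcave.mono hs ht hst))

/-- As `t → 0+`, `bar φ t → 0`, so `1 / bar φ t` eventually exceeds the finite value `fundFn ρX m`.
-/
theorem exists_le_psiTilde (hX : IsRINorm ρX)
    (hunb : ∀ M : ℝ≥0, ∃ t, 0 < t ∧ (M : ℝ≥0∞) < fundFn ρX t) (hφ : BarAdmissible φ) (m : ℝ) :
    ∃ t, 0 < t ∧ m ≤ psiTilde ρX φ t := by
  wlog hm : 0 < m generalizing m
  · obtain ⟨t, h0, ht⟩ := this 1 one_pos
    exact ⟨t, h0, (not_lt.1 hm).trans (zero_le_one.trans ht)⟩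
  have hF : 0 < (fundFn ρX m).toReal :=
    ENNReal.toReal_pos (hX.indicator_Ioo_ne_zero hm) (hX.fundFn_lt_top m).ne
  have h1 := (hφ.tendsto_zero.eventually (gt_mem_nhds (one_div_pos.2 hF))).and
    self_mem_nhdsWithin
  obtain ⟨t, ht, ht0⟩ := h1.exists
  refine ⟨t, ht0, le_fundInv hX hunb hm ?_⟩
  rw [← ENNReal.ofReal_toReal (hX.fundFn_lt_top m).ne]
  refine ENNReal.ofReal_le_ofReal ?_
  rw [le_div_iff₀ (hφ.quasiconcave.pos t ht0), mul_comm, ← le_div_iff₀ hF]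
  exact ht.le

theorem measurable_trunc (f : ℝ → ℝ≥0∞) (s : ℝ) :
    Measurable ((Ioo 0 s).indicator (rearr f)) := (measurable_rearr f).indicator measurableSet_Ioo

theorem trunc_mono (hX : IsRINorm ρX) (f : ℝ → ℝ≥0∞) {s t : ℝ} (hst : s ≤ t) :
    ρX ((Ioo 0 s).indicator (rearr f)) ≤ ρX ((Ioo 0 t).indicator (rearr f)) :=
  hX.mono_everywhere (measurable_trunc f s) (measurable_trunc f t)
    (indicator_le_indicator_of_subset (Ioo_subset_Ioo_right hst) fun _ => zero_le)

theorem R1_antitoneOn (hX : IsRINorm ρX)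
    (hunb : ∀ M : ℝ≥0, ∃ t, 0 < t ∧ (M : ℝ≥0∞) < fundFn ρX t) (hφ : BarAdmissible φ)
    (f : ℝ → ℝ≥0∞) : AntitoneOn (R1 ρX φ f) (Ioi 0) := fun _ hs _ ht hst =>
  mul_le_mul' (ENNReal.ofReal_le_ofReal (one_div_le_one_div_of_le (hφ.pos hs) (hφ.mono hs hst)))
    (trunc_mono hX f (psiTilde_antitoneOn hX hunb hφ hs ht hst))

theorem aemeasurable_R1 (hX : IsRINorm ρX)
    (hunb : ∀ M : ℝ≥0, ∃ t, 0 < t ∧ (M : ℝ≥0∞) < fundFn ρX t) (hφ : BarAdmissible φ)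
    (f : ℝ → ℝ≥0∞) : AEMeasurable (R1 ρX φ f) mu :=
  aemeasurable_restrict_of_antitoneOn measurableSet_Ioi (R1_antitoneOn hX hunb hφ f)

/-- For `t` with `ψ̃(t) ≥ m`, monotonicity of `R1` bounds it below on `(0,t)` by the constant
`φ(t)⁻¹ ‖f^* χ_(0,m)‖_X`, and `χ_(0,t)` has positive finite norm in `Y'`. -/
theorem exists_trunc_le_normR1 (hX : IsRINorm ρX)
    (hunb : ∀ M : ℝ≥0, ∃ t, 0 < t ∧ (M : ℝ≥0∞) < fundFn ρX t) (hφ : BarAdmissible φ)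
    (hY : IsRINorm ρY) (m : ℝ) :
    ∃ K : ℝ≥0, ∀ f, ρX ((Ioo 0 m).indicator (rearr f)) ≤ K * normR1 ρX φ ρY f := by
  obtain ⟨t, ht, hmt⟩ := exists_le_psiTilde hX hunb hφ m
  set c : ℝ≥0∞ := ENNReal.ofReal (1 / φ t)
  have hc : c ≠ 0 := (ENNReal.ofReal_pos.2 (one_div_pos.2 (hφ.pos ht))).ne'
  set α : ℝ≥0∞ := assoc ρY ((Ioo 0 t).indicator 1)
  have hα : α ≠ 0 := (isRINorm_assoc hY).indicator_Ioo_ne_zero ht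
  have hα' : α ≠ ⊤ := ((isRINorm_assoc hY).indicator_Ioo_lt_top t).ne
  have hcα : c * α ≠ 0 := mul_ne_zero hc hα
  have hcα' : c * α ≠ ⊤ := ENNReal.mul_ne_top ENNReal.ofReal_ne_top hα'
  refine ⟨(c * α)⁻¹.toNNReal, fun f => ?_⟩
  rw [ENNReal.coe_toNNReal (ENNReal.inv_ne_top.2 hcα), mul_comm, ← div_eq_mul_inv,
    ENNReal.le_div_iff_mul_le (Or.inl hcα) (Or.inl hcα')]
  set Q := ρX ((Ioo 0 m).indicator (rearr f))
  rw [← mul_assoc, ← assoc_const_mul _ (IsRINorm.aemeasurable_indicator_one measurableSet_Ioo)]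
  refine assoc_mono (Eventually.of_forall fun s => ?_)
  by_cases hs : s ∈ Ioo 0 t
  · change Q * c * (Ioo 0 t).indicator 1 s ≤ _
    rw [indicator_of_mem hs, Pi.one_apply, mul_one, mul_comm]
    refine le_trans ?_ (R1_antitoneOn hX hunb hφ f hs.1 ht hs.2.le)
    exact mul_le_mul_right (trunc_mono hX f hmt) _
  · change Q * c * (Ioo 0 t).indicator 1 s ≤ _
    rw [indicator_of_notMem hs, mul_zero]
    exact zero_le

theorem rearr_indicator_one_le {G : Set ℝ} {m : ℝ} (hG : mu G ≤ ENNReal.ofReal m) {t : ℝ}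
    (ht : 0 < t) : rearr (G.indicator 1) t ≤ (Ioo 0 m).indicator 1 t := by
  by_cases htm : t ∈ Ioo 0 m
  · rw [indicator_of_mem htm, rearr_le_iff]
    rw [show {x | (1 : ℝ → ℝ≥0∞) t < G.indicator (1 : ℝ → ℝ≥0∞) x} = ∅ from ?_]
    · simp
    · refine eq_empty_of_forall_notMem fun x (hx : (1 : ℝ≥0∞) < _) => ?_
      exact absurd hx (not_lt.2 (indicator_le_self (M := ℝ≥0∞) G 1 x))
  · rw [indicator_of_notMem htm, rearr_le_iff]
    refine (measure_mono fun x hx => ?_).trans (hG.trans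
      (ENNReal.ofReal_le_ofReal (not_lt.1 fun h => htm ⟨ht, h⟩)))
    by_contra hn
    rw [mem_ofPred_eq, indicator_of_notMem hn] at hx
    exact lt_irrefl _ hx

/-- Hardy–Littlewood replaces `G` by `(0,|G|)` and `f` by `f^*`; there (P5) for `X` applies to the
truncation controlled by `exists_trunc_le_normR1`. -/
theorem normR1_lintegral_le (hX : IsRINorm ρX)
    (hunb : ∀ M : ℝ≥0, ∃ t, 0 < t ∧ (M : ℝ≥0∞) < fundFn ρX t) (hφ : BarAdmissible φ)
    (hY : IsRINorm ρY) (G : Set ℝ) (hG : MeasurableSet G) (hfin : mu G < ∞) :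
    ∃ C : ℝ≥0, ∀ f, AEMeasurable f mu → ∫⁻ x in G, f x ∂mu ≤ C * normR1 ρX φ ρY f := by
  set m := (mu G).toReal
  have hGm : mu G ≤ ENNReal.ofReal m := (ENNReal.ofReal_toReal hfin.ne).ge
  obtain ⟨C, hC⟩ := hX.lintegral_le (Ioo 0 m) measurableSet_Ioo
    (by rw [mu_Ioo]; exact ENNReal.ofReal_lt_top)
  obtain ⟨K, hK⟩ := exists_trunc_le_normR1 hX hunb hφ hY m
  refine ⟨C * K, fun f hf => ?_⟩
  calc ∫⁻ x in G, f x ∂mu = ∫⁻ x, f x * G.indicator 1 x ∂mu := by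
        rw [← lintegral_indicator hG]
        refine lintegral_congr fun x => ?_
        by_cases hx : x ∈ G <;> simp [hx]
    _ ≤ ∫⁻ x, rearr f x * rearr (G.indicator 1) x ∂mu :=
        lintegral_mul_le_rearr hf (IsRINorm.aemeasurable_indicator_one hG)
    _ ≤ ∫⁻ x, (Ioo 0 m).indicator ((Ioo 0 m).indicator (rearr f)) x ∂mu := by
        apply lintegral_mono_ae
        filter_upwards [mu_Ioi_ae] with x hx
        refine (mul_le_mul_right (rearr_indicator_one_le hGm hx) _).trans (le_of_eq ?_)
        by_cases hx : x ∈ Ioo 0 m <;> simp [hx]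
    _ = ∫⁻ x in Ioo 0 m, (Ioo 0 m).indicator (rearr f) x ∂mu :=
        lintegral_indicator measurableSet_Ioo _
    _ ≤ C * ρX ((Ioo 0 m).indicator (rearr f)) := hC _ (measurable_trunc f m).aemeasurable
    _ ≤ C * (K * normR1 ρX φ ρY f) := by gcongr; exact hK f
    _ = _ := by rw [ENNReal.coe_mul, mul_assoc]

theorem rearr_zero (t : ℝ) : rearr (fun _ => 0) t = 0 :=
  nonpos_iff_eq_zero.1 (rearr_le_iff.2 (by simp))

theorem assoc_weight_lt_top (hφ : BarAdmissible φ)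
    (hmin : (fun t : ℝ => min (1 / φ t) (1 / t)) ∈ space (assoc ρY)) :
    assoc ρY (fun t => ENNReal.ofReal (min (1 / φ t) (1 / t))) < ⊤ := by
  refine lt_of_le_of_lt (assoc_mono ?_) hmin.2
  filter_upwards [mu_Ioi_ae] with t ht
  rw [Real.enorm_of_nonneg (le_min (one_div_pos.2 (hφ.pos ht)).le (one_div_pos.2 ht).le)]

/-- The functional `‖R₁ f‖_{Y'}` is an r.i. norm. -/
theorem isRINorm_normR1 (hX : IsRINorm ρX)
    (hunb : ∀ M : ℝ≥0, ∃ t, 0 < t ∧ (M : ℝ≥0∞) < fundFn ρX t) (hφ : BarAdmissible φ)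
    (hY : IsRINorm ρY) (hmin : (fun t : ℝ => min (1 / φ t) (1 / t)) ∈ space (assoc ρY)) :
    IsRINorm (normR1 ρX φ ρY) where
  eq_zero_iff f hf := by
    constructor
    · intro h
      have h1 : ∀ n : ℕ, ∀ᵐ x ∂mu, x ∈ Ioo (0 : ℝ) n → f x = 0 := fun n => by
        obtain ⟨C, hC⟩ := normR1_lintegral_le hX hunb hφ hY (Ioo (0 : ℝ) n) measurableSet_Ioo
          (by rw [mu_Ioo]; exact ENNReal.ofReal_lt_top)
        refine (ae_restrict_iff' measurableSet_Ioo).1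
          ((lintegral_eq_zero_iff' hf.restrict).1 (nonpos_iff_eq_zero.1 ?_))
        exact (hC f hf).trans (by rw [h, mul_zero])
      filter_upwards [ae_all_iff.2 h1, mu_Ioi_ae] with x hx h0
      obtain ⟨n, hn⟩ := exists_nat_gt x
      exact hx n ⟨h0, hn⟩
    · intro h
      have h1 : R1 ρX φ f = fun _ => 0 := funext fun t => by
        have h2 : rearr f = fun _ => 0 := by
          rw [rearr_congr_ae h]
          exact funext rearr_zero
        rw [R1, h2, indicator_zero, hX.zero, mul_zero]
      rw [normR1, h1]
      exact (isRINorm_assoc hY).zero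
  smul c f _ := by
    rw [normR1, normR1, ← assoc_const_mul _ (aemeasurable_R1 hX hunb hφ f)]
    congr 1
    ext t
    rw [R1, R1, mul_left_comm, ← hX.smul c _ (measurable_trunc f _).aemeasurable]
    congr 2
    ext x
    by_cases hx : x ∈ Ioo 0 (psiTilde ρX φ t) <;> simp [hx, rearr_const_mul]
  add_le f g hf hg := by
    refine le_trans (assoc_mono (Eventually.of_forall fun t => ?_))
      (assoc_add_le (aemeasurable_R1 hX hunb hφ f))
    rw [R1, R1, R1, ← mul_add]
    exact mul_le_mul_right (hX.trunc_add_le hf hg (fundInv_nonneg _ _)) _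
  mono f g _ _ h := assoc_mono (Eventually.of_forall fun t => mul_le_mul_right
    (hX.mono_everywhere (measurable_trunc f _) (measurable_trunc g _) fun x =>
      indicator_le_indicator (rearr_mono_ae h x)) _)
  fatou u f _ _ hm hl := by
    have hmono : ∀ (s x : ℝ), Monotone fun j => (Ioo 0 s).indicator (rearr (u j)) x :=
      fun s x i j hij => indicator_le_indicator (rearr_mono_ae (by
        filter_upwards [hm] with y hy using hy hij) x)
    have hlim : ∀ (s x : ℝ), Tendsto (fun j => (Ioo 0 s).indicator (rearr (u j)) x) atTop
        (𝓝 ((Ioo 0 s).indicator (rearr f) x)) := fun s x => by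
      by_cases hx : x ∈ Ioo 0 s
      · simp only [indicator_of_mem hx]
        exact tendsto_rearr hm hl x
      · simp only [indicator_of_notMem hx]
        exact tendsto_const_nhds
    refine assoc_fatou (fun j => aemeasurable_R1 hX hunb hφ (u j))
      (Eventually.of_forall fun t i j hij => mul_le_mul_right (hX.mono_everywhere
        (measurable_trunc _ _) (measurable_trunc _ _) fun x => hmono _ x hij) _)
      (Eventually.of_forall fun t => tendsto_const_mul_of_monotone _
        (fun i j hij => hX.mono_everywhere (measurable_trunc _ _) (measurable_trunc _ _)
          fun x => hmono _ x hij)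
        (hX.fatou _ _ (fun j => (measurable_trunc _ _).aemeasurable)
          (measurable_trunc _ _).aemeasurable (Eventually.of_forall (hmono _))
          (Eventually.of_forall (hlim _))))
  indicator_lt_top G hG hfin := by
    set B := ρX (G.indicator 1)
    have hB : B < ⊤ := hX.indicator_lt_top G hG hfin
    set w : ℝ → ℝ≥0∞ := fun t => ENNReal.ofReal (min (1 / φ t) (1 / t))
    have hw : assoc ρY w < ⊤ := assoc_weight_lt_top hφ hmin
    have mw : AEMeasurable w mu := hmin.1.ennreal_ofReal
    -- The truncated norm of `χ_G` is at most `B`, and also at most `φ_X(ψ̃(t)) ≤ 2 / bar φ t`;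
    -- after division by `φ t` these match the two terms of the minimum.
    refine lt_of_le_of_lt (assoc_mono (g := fun t => (B + 2) * w t) ?_) ?_
    · filter_upwards [mu_Ioi_ae] with t ht
      have h1 : ρX ((Ioo 0 (psiTilde ρX φ t)).indicator (rearr (G.indicator 1))) ≤ B := by
        refine (hX.mono_everywhere (measurable_trunc _ _) (measurable_rearr (G.indicator 1))
          fun x => indicator_le_self _ _ x).trans ?_
        rw [hX.rearr_eq (IsRINorm.aemeasurable_indicator_one hG)]
      have h2 : ρX ((Ioo 0 (psiTilde ρX φ t)).indicator (rearr (G.indicator 1))) ≤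
          2 * ENNReal.ofReal (1 / bar φ t) := by
        rcases (fundInv_nonneg ρX (1 / bar φ t)).eq_or_lt with h0 | h0
        · rw [psiTilde, ← h0, Ioo_self, indicator_empty, hX.zero]
          exact zero_le
        · refine le_trans ?_ (fundFn_fundInv_le hX h0)
          refine hX.mono_everywhere (measurable_trunc _ _)
            (measurable_one.indicator measurableSet_Ioo) fun x => indicator_le_indicator ?_
          refine rearr_le_iff.2 ?_
          rw [show {y | (1 : ℝ → ℝ≥0∞) x < G.indicator (1 : ℝ → ℝ≥0∞) y} = ∅ from ?_]
          · simp
          · refine eq_empty_of_forall_notMem fun y (hy : (1 : ℝ≥0∞) < _) => ?_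
            exact absurd hy (not_lt.2 (indicator_le_self (M := ℝ≥0∞) G 1 y))
      rcases le_total (1 / φ t) (1 / t) with hle | hle
      · change _ ≤ (B + 2) * ENNReal.ofReal (min (1 / φ t) (1 / t))
        rw [min_eq_left hle, R1, mul_comm]
        gcongr
        exact h1.trans le_self_add
      · change _ ≤ (B + 2) * ENNReal.ofReal (min (1 / φ t) (1 / t))
        rw [min_eq_right hle, ← hφ.one_div_mul_one_div_bar ht,
          ENNReal.ofReal_mul (one_div_pos.2 (hφ.pos ht)).le, R1, mul_left_comm]
        gcongr
        exact h2.trans (mul_le_mul_left le_add_self _)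
    · rw [assoc_const_mul _ mw]
      exact ENNReal.mul_lt_top (ENNReal.add_lt_top.2 ⟨hB, by simp⟩) hw
  lintegral_le := normR1_lintegral_le hX hunb hφ hY
  rearr_inv f g _ _ h := by
    rw [normR1, normR1]
    congr 1
    ext t
    rw [R1, R1, rearr_congr_of_dist (dist_eq_of_rearr_eq h)]

end R1

/-! ### The integral operator on nonnegative functions and its symmetry. -/

/-- The extended-valued antitone extension to the line of a kernel on the half-line. -/
noncomputable def kern (a : ℝ → ℝ) (u : ℝ) : ℝ≥0∞ := if u ≤ 0 then ⊤ else ENNReal.ofReal (a u)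

theorem kern_of_pos (a : ℝ → ℝ) {u : ℝ} (hu : 0 < u) : kern a u = ENNReal.ofReal (a u) :=
  if_neg hu.not_ge

theorem IsKernel.kern_antitone {a : ℝ → ℝ} (ha : IsKernel a) : Antitone (kern a) := fun u v huv => by
  rcases le_or_gt u 0 with hu | hu
  · simp [kern, hu]
  · rw [kern_of_pos a hu, kern_of_pos a (hu.trans_le huv)]
    exact ENNReal.ofReal_le_ofReal (ha.anti hu (hu.trans_le huv) huv)

theorem IsKernel.measurable_kern {a : ℝ → ℝ} (ha : IsKernel a) : Measurable (kern a) :=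
  ha.kern_antitone.measurable

/-- The operator `S_a` on nonnegative extended-valued functions. -/
noncomputable def kernOp (a : ℝ → ℝ) (f : ℝ → ℝ≥0∞) (t : ℝ) : ℝ≥0∞ :=
  ∫⁻ s, kern a (s * t) * f s ∂mu

theorem kernOp_congr_ae (a : ℝ → ℝ) {f g : ℝ → ℝ≥0∞} (h : f =ᵐ[mu] g) : kernOp a f = kernOp a g :=
  funext fun t => lintegral_congr_ae (by filter_upwards [h] with s hs; rw [hs])

theorem kernOp_mono_ae (a : ℝ → ℝ) {f g : ℝ → ℝ≥0∞} (h : f ≤ᵐ[mu] g) (t : ℝ) :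
    kernOp a f t ≤ kernOp a g t :=
  lintegral_mono_ae (by filter_upwards [h] with s hs using mul_le_mul_right hs _)

theorem kernOp_antitoneOn {a : ℝ → ℝ} (ha : IsKernel a) (f : ℝ → ℝ≥0∞) :
    AntitoneOn (kernOp a f) (Ioi 0) := fun t _ t' _ htt => by
  apply lintegral_mono_ae
  filter_upwards [mu_Ioi_ae] with s hs
  exact mul_le_mul_left (ha.kern_antitone (mul_le_mul_of_nonneg_left htt hs.le)) _

theorem aemeasurable_kernOp {a : ℝ → ℝ} (ha : IsKernel a) (f : ℝ → ℝ≥0∞) :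
    AEMeasurable (kernOp a f) mu :=
  aemeasurable_restrict_of_antitoneOn measurableSet_Ioi (kernOp_antitoneOn ha f)

theorem measurable_kern_mul {a : ℝ → ℝ} (ha : IsKernel a) (t : ℝ) :
    Measurable fun s => kern a (s * t) := ha.measurable_kern.comp (measurable_id.mul_const t)

/-- For fixed `t > 0` the map `s ↦ a(st)` is non-increasing, so Hardy–Littlewood rearranges only
`f`. -/
theorem kernOp_le_rearr {a : ℝ → ℝ} (ha : IsKernel a) {f : ℝ → ℝ≥0∞} (hf : AEMeasurable f mu)
    {t : ℝ} (ht : 0 < t) : kernOp a f t ≤ kernOp a (rearr f) t := by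
  refine (lintegral_mul_le_rearr (measurable_kern_mul ha t).aemeasurable hf).trans ?_
  apply lintegral_mono_ae
  filter_upwards [mu_Ioi_ae] with s hs
  refine mul_le_mul_left (rearr_le_self_of_antitoneOn (fun u _ v _ huv => ?_) hs) _
  exact ha.kern_antitone (mul_le_mul_of_nonneg_right huv ht.le)

theorem lintegral_mul_kernOp_swap {a : ℝ → ℝ} (ha : IsKernel a) {f g : ℝ → ℝ≥0∞}
    (hf : Measurable f) (hg : Measurable g) :
    ∫⁻ t, g t * kernOp a f t ∂mu = ∫⁻ s, f s * kernOp a g s ∂mu := by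
  have h1 : ∀ t, g t * kernOp a f t = ∫⁻ s, g t * (kern a (s * t) * f s) ∂mu := fun t =>
    (lintegral_const_mul _ ((measurable_kern_mul ha t).mul hf)).symm
  simp_rw [h1]
  rw [lintegral_lintegral_swap]
  · refine lintegral_congr fun s => ?_
    rw [kernOp, ← lintegral_const_mul (f := fun t => kern a (t * s) * g t) _
      ((measurable_kern_mul ha s).mul hg)]
    refine lintegral_congr fun t => ?_
    rw [mul_comm s t]
    ring
  · exact ((hg.comp measurable_fst).mul ((ha.measurable_kern.comp
      (measurable_snd.mul measurable_fst)).mul (hf.comp measurable_snd))).aemeasurable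

theorem lintegral_mul_kernOp_le {a : ℝ → ℝ} (ha : IsKernel a) {f g : ℝ → ℝ≥0∞}
    (hf : AEMeasurable f mu) (hg : AEMeasurable g mu) :
    ∫⁻ t, g t * kernOp a f t ∂mu ≤ ∫⁻ s, rearr f s * kernOp a (rearr g) s ∂mu := by
  rw [← lintegral_mul_kernOp_swap ha (measurable_rearr f) (measurable_rearr g)]
  refine (lintegral_mul_le_rearr hg (aemeasurable_kernOp ha f)).trans ?_
  apply lintegral_mono_ae
  filter_upwards [mu_Ioi_ae] with t ht
  exact mul_le_mul_right ((rearr_le_self_of_antitoneOn (kernOp_antitoneOn ha f) ht).trans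
    (kernOp_le_rearr ha hf ht)) _

theorem map_mul_mu {t : ℝ} (ht : 0 < t) : mu.map (fun s => s * t) = ENNReal.ofReal (1 / t) • mu := by
  have h := Real.map_volume_mul_right ht.ne'
  rw [abs_of_pos (inv_pos.2 ht), inv_eq_one_div] at h
  unfold mu
  rw [← Measure.restrict_smul, ← h, Measure.restrict_map (measurable_mul_const t) measurableSet_Ioi]
  congr 2
  ext s
  exact (mul_pos_iff_of_pos_right ht).symm

theorem lintegral_comp_mul (F : ℝ → ℝ≥0∞) {t : ℝ} (ht : 0 < t) :
    ∫⁻ s, F (s * t) ∂mu = ENNReal.ofReal (1 / t) * ∫⁻ u, F u ∂mu := by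
  rw [← smul_eq_mul, ← lintegral_smul_measure, ← map_mul_mu ht]
  exact ((measurableEmbedding_mulRight₀ ht.ne').lintegral_map F).symm

theorem map_div_mu_absolutelyContinuous {t : ℝ} (ht : 0 < t) :
    mu.map (fun s => s / t) ≪ mu := by
  simp only [div_eq_mul_inv]
  rw [map_mul_mu (inv_pos.2 ht)]
  exact Measure.smul_absolutelyContinuous

theorem aemeasurable_comp_div {f : ℝ → ℝ≥0∞} (hf : AEMeasurable f mu) {t : ℝ} (ht : 0 < t) :
    AEMeasurable (fun s => f (s / t)) mu :=
  (hf.mono_ac (map_div_mu_absolutelyContinuous ht)).comp_measurable (measurable_id.div_const t)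

theorem kernOp_const {a : ℝ → ℝ} (ha : IsKernel a) (c : ℝ≥0∞) {t : ℝ} (ht : 0 < t) :
    kernOp a (fun _ => c) t = ENNReal.ofReal (1 / t) * (∫⁻ u, kern a u ∂mu) * c := by
  rw [kernOp, lintegral_mul_const _ (measurable_kern_mul ha t), lintegral_comp_mul _ ht]

theorem kernOp_add {a : ℝ → ℝ} (ha : IsKernel a) {f g : ℝ → ℝ≥0∞} (hf : AEMeasurable f mu) (t : ℝ) :
    kernOp a (fun s => f s + g s) t = kernOp a f t + kernOp a g t := by
  simp only [kernOp, mul_add]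
  exact lintegral_add_left' ((measurable_kern_mul ha t).aemeasurable.mul hf) _

/-- Homogeneity is available for finite scalars only; an infinite `c` is reached through finite
scalars below it. -/
theorem IsRINorm.mul_le_of_ae {ρ : (ℝ → ℝ≥0∞) → ℝ≥0∞} (hρ : IsRINorm ρ) {f g : ℝ → ℝ≥0∞}
    (hf : AEMeasurable f mu) (hg : AEMeasurable g mu) {c : ℝ≥0∞}
    (h : ∀ᵐ x ∂mu, c * f x ≤ g x) : c * ρ f ≤ ρ g := by
  refine ENNReal.mul_le_of_forall_lt fun b hb d hd => ?_
  lift b to ℝ≥0 using hb.ne_top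
  refine (mul_le_mul_right hd.le _).trans ?_
  rw [← hρ.smul b f hf]
  refine hρ.mono _ _ (hf.const_mul _) hg ?_
  filter_upwards [h] with x hx using (mul_le_mul_left hb.le _).trans hx

theorem rearr_mul_fundFn_le {ρ : (ℝ → ℝ≥0∞) → ℝ≥0∞} (hρ : IsRINorm ρ) (g : ℝ → ℝ≥0∞) (p : ℝ) :
    rearr g p * fundFn ρ p ≤ ρ ((Ioo 0 p).indicator (rearr g)) := by
  refine hρ.mul_le_of_ae (IsRINorm.aemeasurable_indicator_one measurableSet_Ioo)
    (measurable_trunc g p).aemeasurable (Eventually.of_forall fun x => ?_)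
  by_cases hx : x ∈ Ioo 0 p
  · simpa [hx] using rearr_antitone g hx.2.le
  · simp [hx]

/-! ### Pointwise estimates and boundedness of `S a`. -/

section Bounds

variable {ρX ρY : (ℝ → ℝ≥0∞) → ℝ≥0∞} {φ a : ℝ → ℝ}

theorem kernOp_rearr_le_R1 (hX : IsRINorm ρX)
    (hunb : ∀ M : ℝ≥0, ∃ t, 0 < t ∧ (M : ℝ≥0∞) < fundFn ρX t) (hφ : BarAdmissible φ)
    (ha : IsKernel a) {C : ℝ≥0∞}
    (hC : ∀ h, AEMeasurable h mu → ∀ t, 0 < t →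
      kernOp a h t ≤ C * (ENNReal.ofReal (1 / φ t) * ρX h))
    (g : ℝ → ℝ≥0∞) {t : ℝ} (ht : 0 < t) (hp : 0 < psiTilde ρX φ t) :
    kernOp a (rearr g) t ≤ (C + 2 * ∫⁻ u, kern a u ∂mu) * R1 ρX φ g t := by
  set p := psiTilde ρX φ t
  set A := ∫⁻ u, kern a u ∂mu
  -- Cut at `p`: the truncation is handled by `hC`, the constant tail by integrability of the
  -- kernel.
  have h1 : rearr g ≤ᵐ[mu] fun s => (Ioo 0 p).indicator (rearr g) s + rearr g p := by
    filter_upwards [mu_Ioi_ae] with s hs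
    rcases lt_or_ge s p with hsp | hsp
    · rw [indicator_of_mem (show s ∈ Ioo 0 p from ⟨hs, hsp⟩)]
      exact le_self_add
    · exact (rearr_antitone g hsp).trans le_add_self
  refine (kernOp_mono_ae a h1 t).trans ?_
  rw [kernOp_add ha (measurable_trunc g p).aemeasurable, kernOp_const ha _ ht, add_mul]
  refine add_le_add (hC _ (measurable_trunc g p).aemeasurable t ht) ?_
  rw [← hφ.one_div_mul_one_div_bar ht, ENNReal.ofReal_mul (one_div_pos.2 (hφ.pos ht)).le]
  calc ENNReal.ofReal (1 / φ t) * ENNReal.ofReal (1 / bar φ t) * A * rearr g p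
      ≤ ENNReal.ofReal (1 / φ t) * (2 * fundFn ρX p) * A * rearr g p := by
        gcongr
        exact le_fundFn_fundInv hX hunb hp
    _ = 2 * A * (ENNReal.ofReal (1 / φ t) * (rearr g p * fundFn ρX p)) := by ring
    _ ≤ 2 * A * R1 ρX φ g t := by
        rw [R1]
        gcongr
        exact rearr_mul_fundFn_le hX g p

/-- Where `ψ̃` vanishes, `S_a g^*` is controlled by the weight `min(1/φ(t), 1/t)`. -/
theorem exists_kernOp_rearr_le_weight (hX : IsRINorm ρX)
    (hunb : ∀ M : ℝ≥0, ∃ t, 0 < t ∧ (M : ℝ≥0∞) < fundFn ρX t) (hφ : BarAdmissible φ)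
    (hY : IsRINorm ρY) (ha : IsKernel a) (hA : ∫⁻ u, kern a u ∂mu ≠ ⊤) :
    ∃ K : ℝ≥0∞, K ≠ ⊤ ∧ ∀ g, normR1 ρX φ ρY g ≤ 1 → ∀ t, 0 < t → psiTilde ρX φ t = 0 →
      kernOp a (rearr g) t ≤ K * ENNReal.ofReal (min (1 / φ t) (1 / t)) := by
  by_cases hex : ∃ t, 0 < t ∧ psiTilde ρX φ t = 0
  swap
  · exact ⟨0, ENNReal.zero_ne_top, fun g _ t ht h => absurd ⟨t, ht, h⟩ hex⟩
  obtain ⟨t₁, ht₁, hψ₁⟩ := hex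
  set A := ∫⁻ u, kern a u ∂mu
  set c : ℝ≥0∞ := ENNReal.ofReal (1 / bar φ t₁)
  have hc : c ≠ 0 :=
    (ENNReal.ofReal_pos.2 (one_div_pos.2 (hφ.quasiconcave.pos t₁ ht₁))).ne'
  -- A zero of `ψ̃` forces the fundamental function to stay above `c`, so finite truncated norms
  -- bound `g^*`.
  have hc' : ∀ s, 0 < s → c ≤ fundFn ρX s := fun s hs =>
    (lt_fundFn_of_fundInv_lt hX hunb hs (lt_of_eq_of_lt hψ₁ hs)).le
  -- Since `ψ̃ ≥ 1` at `t₂` and `ψ̃` is non-increasing, it can vanish only beyond `t₂`. There `bar φ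
  -- t ≥ bar φ t₂`, which makes `1/t` at most `D` times the weight.
  obtain ⟨t₂, ht₂, hψ₂⟩ := exists_le_psiTilde hX hunb hφ 1
  obtain ⟨K, hK⟩ := exists_trunc_le_normR1 hX hunb hφ hY 1
  set D : ℝ≥0∞ := ENNReal.ofReal (max 1 (1 / bar φ t₂))
  refine ⟨D * A * (K / c), ENNReal.mul_ne_top (ENNReal.mul_ne_top ENNReal.ofReal_ne_top hA)
    (ENNReal.div_ne_top ENNReal.coe_ne_top hc), fun g hg t ht hψ => ?_⟩
  have hlt : t₂ ≤ t := by
    by_contra! h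
    have := psiTilde_antitoneOn hX hunb hφ ht ht₂ h.le
    linarith
  have hg' : ∀ s, 0 < s → rearr g s ≤ K / c := fun s hs => by
    refine (rearr_antitone g (min_le_left s 1)).trans ?_
    rw [ENNReal.le_div_iff_mul_le (Or.inl hc) (Or.inl ENNReal.ofReal_ne_top)]
    calc rearr g (min s 1) * c ≤ rearr g (min s 1) * fundFn ρX (min s 1) := by
          gcongr
          exact hc' _ (lt_min hs one_pos)
      _ ≤ ρX ((Ioo 0 (min s 1)).indicator (rearr g)) := rearr_mul_fundFn_le hX g _
      _ ≤ ρX ((Ioo 0 1).indicator (rearr g)) := trunc_mono hX g (min_le_right _ _)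
      _ ≤ K * normR1 ρX φ ρY g := hK g
      _ ≤ K := mul_le_of_le_one_right' hg
  have hw : ENNReal.ofReal (1 / t) ≤ D * ENNReal.ofReal (min (1 / φ t) (1 / t)) := by
    rw [← ENNReal.ofReal_mul (zero_le_one.trans (le_max_left _ _))]
    refine ENNReal.ofReal_le_ofReal ?_
    rw [mul_min_of_nonneg _ _ (zero_le_one.trans (le_max_left _ _))]
    refine le_min ?_ ?_
    · rw [← hφ.one_div_mul_one_div_bar ht, mul_comm]
      refine mul_le_mul_of_nonneg_right (le_trans ?_ (le_max_right _ _))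
        (one_div_pos.2 (hφ.pos ht)).le
      exact one_div_le_one_div_of_le (hφ.quasiconcave.pos t₂ ht₂)
        (hφ.quasiconcave.mono ht₂ ht hlt)
    · exact le_mul_of_one_le_left (one_div_pos.2 ht).le (le_max_left _ _)
  have h1 : rearr g ≤ᵐ[mu] fun _ => K / c := by
    filter_upwards [mu_Ioi_ae] with s hs using hg' s hs
  refine (kernOp_mono_ae a h1 t).trans ?_
  rw [kernOp_const ha _ ht]
  calc _ ≤ D * ENNReal.ofReal (min (1 / φ t) (1 / t)) * A * (K / c) := by gcongr
    _ = _ := by ring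

/-- The core duality estimate: `S_a` is moved onto `g^*`, dominated pointwise by `R1` plus the
weight, and Hölder is applied between `Y` and `Y'`. -/
theorem exists_assoc_kernOp_le (hX : IsRINorm ρX)
    (hunb : ∀ M : ℝ≥0, ∃ t, 0 < t ∧ (M : ℝ≥0∞) < fundFn ρX t) (hφ : BarAdmissible φ)
    (hY : IsRINorm ρY) (hmin : (fun t : ℝ => min (1 / φ t) (1 / t)) ∈ space (assoc ρY))
    (ha : IsKernel a) (hA : ∫⁻ u, kern a u ∂mu ≠ ⊤) {C : ℝ≥0∞} (hCtop : C ≠ ⊤)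
    (hC : ∀ h, AEMeasurable h mu → ∀ t, 0 < t →
      kernOp a h t ≤ C * (ENNReal.ofReal (1 / φ t) * ρX h)) :
    ∃ K : ℝ≥0, ∀ f, AEMeasurable f mu → ρY f ≠ ⊤ →
      assoc (normR1 ρX φ ρY) (kernOp a f) ≤ K * ρY f := by
  obtain ⟨K₂, hK₂, hK₂'⟩ := exists_kernOp_rearr_le_weight hX hunb hφ hY ha hA
  set K₁ := C + 2 * ∫⁻ u, kern a u ∂mu
  have hK₁ : K₁ ≠ ⊤ := by finiteness
  set w : ℝ → ℝ≥0∞ := fun t => ENNReal.ofReal (min (1 / φ t) (1 / t))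
  have hw : assoc ρY w < ⊤ := assoc_weight_lt_top hφ hmin
  have mw : AEMeasurable w mu := hmin.1.ennreal_ofReal
  have hfin : K₁ + K₂ * assoc ρY w ≠ ⊤ := by finiteness
  refine ⟨(K₁ + K₂ * assoc ρY w).toNNReal, fun f hf hf' => assoc_le fun g hg hg1 => ?_⟩
  rw [ENNReal.coe_toNNReal hfin]
  have mR := aemeasurable_R1 hX hunb hφ g
  calc ∫⁻ t, g t * kernOp a f t ∂mu ≤ ∫⁻ s, rearr f s * kernOp a (rearr g) s ∂mu :=
        lintegral_mul_kernOp_le ha hf hg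
    _ ≤ ∫⁻ s, rearr f s * (K₁ * R1 ρX φ g s + K₂ * w s) ∂mu := by
        apply lintegral_mono_ae
        filter_upwards [mu_Ioi_ae] with s hs
        refine mul_le_mul_right ?_ _
        rcases (fundInv_nonneg ρX (1 / bar φ s)).eq_or_lt with h0 | h0
        · exact (hK₂' g hg1 s hs h0.symm).trans le_add_self
        · exact (kernOp_rearr_le_R1 hX hunb hφ ha hC g hs h0).trans le_self_add
    _ ≤ ρY (rearr f) * assoc ρY (fun s => K₁ * R1 ρX φ g s + K₂ * w s) :=
        lintegral_mul_le_mul_assoc hY (measurable_rearr f).aemeasurable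
          (by rwa [hY.rearr_eq hf]) _
    _ ≤ ρY f * (K₁ * assoc ρY (R1 ρX φ g) + K₂ * assoc ρY w) := by
        rw [hY.rearr_eq hf, ← assoc_const_mul _ mR, ← assoc_const_mul _ mw]
        gcongr
        exact assoc_add_le (mR.const_mul _)
    _ ≤ ρY f * (K₁ * 1 + K₂ * assoc ρY w) := by
        gcongr
        exact hg1
    _ = _ := by rw [mul_one, mul_comm]

theorem enorm_kernel_mul (ha : IsKernel a) (f : ℝ → ℝ) {s t : ℝ} (hs : 0 < s) (ht : 0 < t) :
    ‖a (s * t) * f s‖ₑ = kern a (s * t) * ‖f s‖ₑ := by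
  rw [enorm_mul, Real.enorm_of_nonneg (ha.nonneg _ (mul_pos hs ht)), kern_of_pos a (mul_pos hs ht)]

theorem kernel_eq_toReal_kern (ha : IsKernel a) {u : ℝ} (hu : 0 < u) : a u = (kern a u).toReal := by
  rw [kern_of_pos a hu, ENNReal.toReal_ofReal (ha.nonneg _ hu)]

theorem enorm_S_le (ha : IsKernel a) (f : ℝ → ℝ) {t : ℝ} (ht : 0 < t) :
    ‖S a f t‖ₑ ≤ kernOp a (fun s => ‖f s‖ₑ) t := by
  refine (enorm_integral_le_lintegral_enorm _).trans (le_of_eq (lintegral_congr_ae ?_))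
  filter_upwards [mu_Ioi_ae] with s hs using enorm_kernel_mul ha f hs ht

theorem integrable_kernel_mul (ha : IsKernel a) {f : ℝ → ℝ} (hf : AEMeasurable f mu) {t : ℝ}
    (ht : 0 < t) (h : kernOp a (fun s => ‖f s‖ₑ) t ≠ ⊤) :
    Integrable (fun s => a (s * t) * f s) mu := by
  refine ⟨?_, ?_⟩
  · have h1 : AEMeasurable (fun s => (kern a (s * t)).toReal * f s) mu :=
      (measurable_kern_mul ha t).ennreal_toReal.aemeasurable.mul hf
    refine (h1.congr ?_).aestronglyMeasurable
    filter_upwards [mu_Ioi_ae] with s hs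
    rw [kernel_eq_toReal_kern ha (mul_pos hs ht)]
  · refine lt_of_le_of_lt (le_of_eq (lintegral_congr_ae ?_)) h.lt_top
    filter_upwards [mu_Ioi_ae] with s hs using enorm_kernel_mul ha f hs ht

theorem aemeasurable_S (ha : IsKernel a) {f : ℝ → ℝ} (hf : AEMeasurable f mu) :
    AEMeasurable (S a f) mu := by
  have h1 : StronglyMeasurable fun t => ∫ s, (kern a (s * t)).toReal * hf.mk f s ∂mu := by
    refine StronglyMeasurable.integral_prod_right
      (f := fun t s => (kern a (s * t)).toReal * hf.mk f s) (Measurable.stronglyMeasurable ?_)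
    exact (ha.measurable_kern.comp (measurable_snd.mul measurable_fst)).ennreal_toReal.mul
      (hf.measurable_mk.comp measurable_snd)
  refine h1.measurable.aemeasurable.congr ?_
  filter_upwards [mu_Ioi_ae] with t ht
  refine integral_congr_ae ?_
  filter_upwards [mu_Ioi_ae, hf.ae_eq_mk] with s hs hfs
  rw [kernel_eq_toReal_kern ha (mul_pos hs ht), hfs]

theorem sBounded_of_kernOp_bound (hX : IsRINorm ρX)
    (hunb : ∀ M : ℝ≥0, ∃ t, 0 < t ∧ (M : ℝ≥0∞) < fundFn ρX t) (hφ : BarAdmissible φ)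
    (hY : IsRINorm ρY) (hsub : space ρY ⊆ sumSpace (space ρX) (space normLinf))
    (hmin : (fun t : ℝ => min (1 / φ t) (1 / t)) ∈ space (assoc ρY))
    (ha : IsKernel a) (hA : ∫⁻ u, kern a u ∂mu ≠ ⊤) {C : ℝ≥0∞} (hCtop : C ≠ ⊤)
    (hC : ∀ h, AEMeasurable h mu → ∀ t, 0 < t →
      kernOp a h t ≤ C * (ENNReal.ofReal (1 / φ t) * ρX h)) :
    SBounded a ρY (assoc (normR1 ρX φ ρY)) := by
  obtain ⟨K, hK⟩ := exists_assoc_kernOp_le hX hunb hφ hY hmin ha hA hCtop hC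
  refine ⟨K, fun f hf => ?_⟩
  have hbound : assoc (normR1 ρX φ ρY) (fun t => ‖S a f t‖ₑ) ≤ K * ρY (fun x => ‖f x‖ₑ) := by
    refine (assoc_mono ?_).trans (hK _ hf.1.enorm hf.2.ne)
    filter_upwards [mu_Ioi_ae] with t ht using enorm_S_le ha f ht
  refine ⟨fun t ht => integrable_kernel_mul ha hf.1 ht ?_, ⟨aemeasurable_S ha hf.1,
    hbound.trans_lt (ENNReal.mul_lt_top ENNReal.coe_lt_top hf.2)⟩, hbound⟩
  -- The decomposition in `X + L^∞` yields absolute convergence: `hC` controls the `X` part, and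
  -- integrability of the kernel the bounded part.
  obtain ⟨g, hg, h, hh, rfl⟩ := hsub hf
  have h1 : (fun s => ‖(g + h) s‖ₑ) ≤ᵐ[mu] fun s => ‖g s‖ₑ + normLinf (fun x => ‖h x‖ₑ) := by
    filter_upwards [ENNReal.ae_le_essSup (μ := mu) (fun x => ‖h x‖ₑ)] with s hs
    exact (enorm_add_le _ _).trans (add_le_add_right hs _)
  refine ne_top_of_le_ne_top ?_ (kernOp_mono_ae a h1 t)
  rw [kernOp_add ha hg.1.enorm, kernOp_const ha _ ht]
  have h2 : kernOp a (fun s => ‖g s‖ₑ) t ≠ ⊤ := ne_top_of_le_ne_top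
    (ENNReal.mul_ne_top hCtop (ENNReal.mul_ne_top ENNReal.ofReal_ne_top hg.2.ne))
    (hC _ hg.1.enorm t ht)
  have h3 := hh.2.ne
  finiteness

theorem mul_ofReal_mul_top_eq (hφ : BarAdmissible φ) {C : ℝ≥0∞} (hC : C ≠ 0) {t : ℝ} (ht : 0 < t) :
    C * (ENNReal.ofReal (1 / φ t) * ⊤) = ⊤ := by
  rw [ENNReal.mul_top (ENNReal.ofReal_pos.2 (one_div_pos.2 (hφ.pos ht))).ne', ENNReal.mul_top hC]

theorem ofReal_one_div_mul_cancel (hφ : BarAdmissible φ) {t : ℝ} (ht : 0 < t) :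
    ENNReal.ofReal (1 / φ t) * ENNReal.ofReal (φ t) = 1 := by
  rw [← ENNReal.ofReal_mul (one_div_pos.2 (hφ.pos ht)).le, one_div_mul_cancel (hφ.pos ht).ne',
    ENNReal.ofReal_one]

/-- Since `S_a h` is non-increasing, its value at `t` is at most its rearrangement at `t/2`, where
the `m_φ` bound applies; `φ(t) ≤ 2 φ(t/2)` produces the factor 2. -/
theorem exists_kernOp_bound_of_sBounded (hX : IsRINorm ρX) (hφ : BarAdmissible φ) (ha : IsKernel a)
    (hS : SBounded a ρX (normM φ)) :
    ∃ C : ℝ≥0∞, C ≠ ⊤ ∧ ∀ h, AEMeasurable h mu → ∀ t, 0 < t →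
      kernOp a h t ≤ C * (ENNReal.ofReal (1 / φ t) * ρX h) := by
  obtain ⟨C, hC⟩ := hS
  -- The `+ 1` keeps the constant nonzero, so the right side is `⊤` when `ρX h = ⊤`.
  refine ⟨2 * C + 1, by finiteness, fun h hh t ht => ?_⟩
  rcases eq_or_ne (ρX h) ⊤ with htop | htop
  · rw [htop, mul_ofReal_mul_top_eq hφ (by simp) ht]
    exact le_top
  set f : ℝ → ℝ := fun s => (h s).toReal
  have mf : AEMeasurable f mu := hh.ennreal_toReal
  have hfh : (fun s => ‖f s‖ₑ) =ᵐ[mu] h := by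
    filter_upwards [hX.ae_lt_top hh htop] with s hs
    rw [Real.enorm_of_nonneg ENNReal.toReal_nonneg, ENNReal.ofReal_toReal hs.ne]
  have hρ : ρX (fun s => ‖f s‖ₑ) = ρX h := hX.congr_ae mf.enorm hh hfh
  obtain ⟨hint, -, hle⟩ := hC f ⟨mf, by rw [hρ]; exact htop.lt_top⟩
  rw [hρ] at hle
  have hSk : (fun t => ‖S a f t‖ₑ) =ᵐ[mu] kernOp a h := by
    filter_upwards [mu_Ioi_ae] with t ht
    have hnn : 0 ≤ᵐ[mu] fun s => a (s * t) * f s := by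
      filter_upwards [mu_Ioi_ae] with s hs
      exact mul_nonneg (ha.nonneg _ (mul_pos hs ht)) ENNReal.toReal_nonneg
    rw [← kernOp_congr_ae a hfh, S, Real.enorm_of_nonneg (integral_nonneg_of_ae hnn),
      ofReal_integral_eq_lintegral_ofReal (hint t ht) hnn]
    refine lintegral_congr_ae ?_
    filter_upwards [mu_Ioi_ae, hnn] with s hs h0
    rw [← Real.enorm_of_nonneg h0, enorm_kernel_mul ha f hs ht]
  have h1 : ENNReal.ofReal (φ (t / 2)) * rearr (kernOp a h) (t / 2) ≤ C * ρX h := by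
    rw [← rearr_congr_ae hSk]
    exact le_trans (le_iSup₂_of_le (f := fun t (_ : 0 < t) => ENNReal.ofReal (φ t) *
      rearr (fun t => ‖S a f t‖ₑ) t) (t / 2) (half_pos ht) le_rfl) hle
  have h2 : kernOp a h t ≤ rearr (kernOp a h) (t / 2) :=
    le_rearr_of_antitoneOn (kernOp_antitoneOn ha h) (half_pos ht).le (half_lt_self ht)
  have h3 : ENNReal.ofReal (φ t) ≤ 2 * ENNReal.ofReal (φ (t / 2)) := by
    rw [← ENNReal.ofReal_ofNat, ← ENNReal.ofReal_mul zero_le_two]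
    exact ENNReal.ofReal_le_ofReal (hφ.le_two_mul_half ht)
  calc kernOp a h t = ENNReal.ofReal (1 / φ t) * (ENNReal.ofReal (φ t) * kernOp a h t) := by
        rw [← mul_assoc, ofReal_one_div_mul_cancel hφ ht, one_mul]
    _ ≤ ENNReal.ofReal (1 / φ t) *
        (2 * ENNReal.ofReal (φ (t / 2)) * rearr (kernOp a h) (t / 2)) := by gcongr
    _ ≤ ENNReal.ofReal (1 / φ t) * (2 * (C * ρX h)) := by
        rw [mul_assoc 2]
        gcongr
    _ = 2 * C * (ENNReal.ofReal (1 / φ t) * ρX h) := by ring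
    _ ≤ _ := by
        gcongr
        exact le_self_add

theorem lintegral_kern_eq (ha : IsKernel a) : ∫⁻ u, kern a u ∂mu = ∫⁻ u, ‖a u‖ₑ ∂mu := by
  refine lintegral_congr_ae ?_
  filter_upwards [mu_Ioi_ae] with s hs
  rw [kern_of_pos a hs, Real.enorm_of_nonneg (ha.nonneg s hs)]

theorem lintegral_kern_ne_top_of_sBounded {N : (ℝ → ℝ≥0∞) → ℝ≥0∞} (ha : IsKernel a)
    (hS : SBounded a normLinf N) : ∫⁻ u, kern a u ∂mu ≠ ⊤ := by
  obtain ⟨C, hC⟩ := hS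
  have h1 : (fun _ => 1 : ℝ → ℝ) ∈ space normLinf := by
    refine ⟨aemeasurable_const, lt_of_le_of_lt (b := 1) ?_ ENNReal.one_lt_top⟩
    exact essSup_le_of_ae_le _ (Eventually.of_forall fun x => by simp)
  -- Absolute convergence for the constant function `1` at `t = 1` is integrability of `a`.
  have h2 := ((hC _ h1).1 1 one_pos).2
  simp only [mul_one] at h2
  rw [lintegral_kern_eq ha]
  exact h2.ne

end Bounds

/-! ### Dilation norms and the case `φ = E(X)`. -/

section Dilation

variable {ρ : (ℝ → ℝ≥0∞) → ℝ≥0∞} {a : ℝ → ℝ}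

theorem dilation_le (hρ : IsRINorm ρ) {f : ℝ → ℝ≥0∞} (hf : AEMeasurable f mu) (hf' : ρ f ≠ ⊤)
    {t : ℝ} (ht : 0 < t) : ρ (fun s => f (s / t)) ≤ dilationNorm ρ t * ρ f := by
  have mft := aemeasurable_comp_div hf ht
  rcases eq_or_ne (ρ f) 0 with h0 | h0
  · have h1 := ae_of_ae_map (measurable_id.div_const t).aemeasurable
      ((map_div_mu_absolutelyContinuous ht).ae_le ((hρ.eq_zero_iff f hf).1 h0))
    rw [(hρ.eq_zero_iff _ mft).2 h1]
    exact zero_le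
  · set c : ℝ≥0 := ((ρ f).toNNReal)⁻¹ with hc
    have hcc : (c : ℝ≥0∞) = (ρ f)⁻¹ := by
      rw [hc, ENNReal.coe_inv (by simp [ENNReal.toNNReal_eq_zero_iff, h0, hf']),
        ENNReal.coe_toNNReal hf']
    have h1 : ρ (fun s => c * f (s / t)) ≤ dilationNorm ρ t :=
      le_iSup_of_le (fun s => c * f s) (le_iSup_of_le (hf.const_mul _) (le_iSup_of_le
        (by rw [hρ.smul c f hf, hcc, ENNReal.inv_mul_cancel h0 hf']) le_rfl))
    rw [hρ.smul c _ mft, hcc, mul_comm, ← div_eq_mul_inv] at h1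
    exact (ENNReal.div_le_iff h0 hf').1 h1

theorem fundFn_mul_le (hρ : IsRINorm ρ) (r : ℝ) {t : ℝ} (ht : 0 < t) :
    fundFn ρ (r * t) ≤ dilationNorm ρ t * fundFn ρ r := by
  refine le_trans (le_of_eq ?_) (dilation_le hρ
    (IsRINorm.aemeasurable_indicator_one measurableSet_Ioo) (hρ.fundFn_lt_top r).ne ht)
  rw [fundFn]
  congr 1
  ext s
  simp only [indicator_apply, mem_Ioo, div_pos_iff_of_pos_right ht, div_lt_iff₀ ht, Pi.one_apply]

theorem bar_EFn (ρ : (ℝ → ℝ≥0∞) → ℝ≥0∞) {t : ℝ} (ht : 0 < t) :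
    bar (EFn ρ) t = (dilationNorm ρ t).toReal := by
  unfold bar EFn
  rw [div_div_cancel₀ ht.ne']

/-- `toReal` sends `⊤` to `0`, so positivity of `bar (EFn ρ) t` rules out an infinite dilation norm.
-/
theorem dilationNorm_eq (hφ : BarAdmissible (EFn ρ)) {t : ℝ} (ht : 0 < t) :
    dilationNorm ρ t = ENNReal.ofReal (bar (EFn ρ) t) := by
  have h := hφ.quasiconcave.pos t ht
  rw [bar_EFn ρ ht] at h ⊢
  rw [ENNReal.ofReal_toReal (ENNReal.toReal_pos_iff.1 h).2.ne]

/-- From `φ_X(1) ≤ ‖E_t‖ φ_X(1/t)` and `‖E_t‖ → 0` as `t → 0+`, the values `φ_X(1/t)` must blow up.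
-/
theorem fundFn_unbounded (hρ : IsRINorm ρ) (hφ : BarAdmissible (EFn ρ)) (M : ℝ≥0) :
    ∃ t, 0 < t ∧ (M : ℝ≥0∞) < fundFn ρ t := by
  set F := (fundFn ρ 1).toReal
  have hF0 : 0 < F :=
    ENNReal.toReal_pos (hρ.indicator_Ioo_ne_zero one_pos) (hρ.fundFn_lt_top 1).ne
  have hM : (0 : ℝ) < M + 1 := by positivity
  obtain ⟨t, ht, ht0⟩ := ((hφ.tendsto_zero.eventually (gt_mem_nhds (div_pos hF0 hM))).and
    self_mem_nhdsWithin).exists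
  refine ⟨1 / t, one_div_pos.2 ht0, ?_⟩
  by_contra! hle
  have hb := hφ.quasiconcave.pos t ht0
  have h1 : fundFn ρ 1 ≤ ENNReal.ofReal (bar (EFn ρ) t * M) := by
    have := fundFn_mul_le hρ (1 / t) ht0
    rw [one_div_mul_cancel (ne_of_gt ht0), dilationNorm_eq hφ ht0] at this
    rw [ENNReal.ofReal_mul hb.le, ENNReal.ofReal_coe_nnreal]
    exact this.trans (mul_le_mul_right hle _)
  have h2 : F ≤ bar (EFn ρ) t * M :=
    ENNReal.toReal_le_of_le_ofReal (mul_nonneg hb.le M.coe_nonneg) h1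
  rw [lt_div_iff₀ hM] at ht
  nlinarith

/-- The substitution `u = st` turns `S_a h(t)` into `t⁻¹ ∫ (E_t h) a`, to which Hölder applies. -/
theorem exists_kernOp_bound_of_mem_assoc (hρ : IsRINorm ρ) (hφ : BarAdmissible (EFn ρ))
    (ha : IsKernel a) (haX : a ∈ space (assoc ρ)) :
    ∃ C : ℝ≥0∞, C ≠ ⊤ ∧ ∀ h, AEMeasurable h mu → ∀ t, 0 < t →
      kernOp a h t ≤ C * (ENNReal.ofReal (1 / EFn ρ t) * ρ h) := by
  have hk : assoc ρ (kern a) ≤ assoc ρ (fun x => ‖a x‖ₑ) := by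
    refine assoc_mono ?_
    filter_upwards [mu_Ioi_ae] with s hs
    rw [kern_of_pos a hs, Real.enorm_of_nonneg (ha.nonneg s hs)]
  have hk' : assoc ρ (kern a) ≠ ⊤ := ne_top_of_le_ne_top haX.2.ne hk
  refine ⟨assoc ρ (kern a) + 1, by finiteness, fun h hh t ht => ?_⟩
  rcases eq_or_ne (ρ h) ⊤ with htop | htop
  · rw [htop, mul_ofReal_mul_top_eq hφ (by simp) ht]
    exact le_top
  have hd := dilation_le hρ hh htop ht
  have hdt : dilationNorm ρ t * ρ h ≠ ⊤ := by
    rw [dilationNorm_eq hφ ht]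
    finiteness
  have hE : ENNReal.ofReal (1 / t) * dilationNorm ρ t = ENNReal.ofReal (1 / EFn ρ t) := by
    rw [dilationNorm_eq hφ ht, ← ENNReal.ofReal_mul (one_div_pos.2 ht).le]
    congr 1
    have := (hφ.pos ht).ne'
    unfold bar
    field_simp
  calc kernOp a h t = ∫⁻ s, (fun u => h (u / t) * kern a u) (s * t) ∂mu := by
        refine lintegral_congr fun s => ?_
        change _ = h (s * t / t) * kern a (s * t)
        rw [mul_div_cancel_right₀ s ht.ne', mul_comm]
    _ = ENNReal.ofReal (1 / t) * ∫⁻ u, h (u / t) * kern a u ∂mu :=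
        lintegral_comp_mul (fun u => h (u / t) * kern a u) ht
    _ ≤ ENNReal.ofReal (1 / t) * (ρ (fun u => h (u / t)) * assoc ρ (kern a)) := by
        gcongr
        exact lintegral_mul_le_mul_assoc hρ (aemeasurable_comp_div hh ht)
          (ne_top_of_le_ne_top hdt hd) _
    _ ≤ ENNReal.ofReal (1 / t) * (dilationNorm ρ t * ρ h * assoc ρ (kern a)) := by gcongr
    _ = assoc ρ (kern a) * (ENNReal.ofReal (1 / EFn ρ t) * ρ h) := by
        rw [← hE]
        ring
    _ ≤ _ := by
        gcongr
        exact le_self_add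

end Dilation

end RISpace

theorem mainTheorem7 :
    -- the theorem, for a general function `φ`
    (∀ (ρX : (ℝ → ℝ≥0∞) → ℝ≥0∞) (φ : ℝ → ℝ) (ρY : (ℝ → ℝ≥0∞) → ℝ≥0∞),
      IsRINorm ρX →
      StrictMonoOn (fundFn ρX) (Ioi 0) →
      (∀ M : ℝ≥0, ∃ t, 0 < t ∧ (M : ℝ≥0∞) < fundFn ρX t) →
      BarAdmissible φ →
      StrictMonoOn (bar φ) (Ioi 0) →
      IsRINorm ρY →
      space ρY ⊆ sumSpace (space ρX) (space normLinf) →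
      (fun t : ℝ => min (1 / φ t) (1 / t)) ∈ space (assoc ρY) →
      IsRINorm (normR1 ρX φ ρY) ∧
      IsRINorm (assoc (normR1 ρX φ ρY)) ∧
      ∀ a : ℝ → ℝ, IsKernel a →
        SBounded a ρX (normM φ) →
        SBounded a normLinf normWeakL1 →
        SBounded a ρY (assoc (normR1 ρX φ ρY))) ∧
    -- the corollary, with `φ = E(X)`
    (∀ (ρX : (ℝ → ℝ≥0∞) → ℝ≥0∞) (ρY : (ℝ → ℝ≥0∞) → ℝ≥0∞),
      IsRINorm ρX →
      BarAdmissible (EFn ρX) →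
      StrictMonoOn (bar (EFn ρX)) (Ioi 0) →
      IsRINorm ρY →
      space ρY ⊆ sumSpace (space ρX) (space normLinf) →
      (fun t : ℝ => min (1 / EFn ρX t) (1 / t)) ∈ space (assoc ρY) →
      IsRINorm (normR1 ρX (EFn ρX) ρY) ∧
      IsRINorm (assoc (normR1 ρX (EFn ρX) ρY)) ∧
      ∀ a : ℝ → ℝ, IsKernel a →
        a ∈ space (assoc ρX) ∩ space normL1 →
        SBounded a ρY (assoc (normR1 ρX (EFn ρX) ρY))) := by
  constructor
  · intro ρX φ ρY hX _ hunb hφ _ hY hsub hmin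
    have hR := isRINorm_normR1 hX hunb hφ hY hmin
    refine ⟨hR, isRINorm_assoc hR, fun a ha hS hL => ?_⟩
    obtain ⟨C, hCtop, hC⟩ := exists_kernOp_bound_of_sBounded hX hφ ha hS
    exact sBounded_of_kernOp_bound hX hunb hφ hY hsub hmin ha
      (lintegral_kern_ne_top_of_sBounded ha hL) hCtop hC
  · intro ρX ρY hX hφ _ hY hsub hmin
    have hunb := fundFn_unbounded hX hφ
    have hR := isRINorm_normR1 hX hunb hφ hY hmin
    refine ⟨hR, isRINorm_assoc hR, fun a ha haX => ?_⟩
    obtain ⟨C, hCtop, hC⟩ := exists_kernOp_bound_of_mem_assoc hX hφ ha haX.1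
    refine sBounded_of_kernOp_bound hX hunb hφ hY hsub hmin ha ?_ hCtop hC
    rw [lintegral_kern_eq ha]
    exact haX.2.2.ne
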